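/- **Theorem (Robust Nonlinear Integral Control).** For $v\in\mathbb R^3$ let $S(v)$ be the skew matrix with $S(v)b=v\times b$, and let $Z(q)=\tfrac12\big[\tfrac{1-q^Tq}{2}I+qq^T+S(q)\big]$ be the kinematic matrix of the modified Rodrigues parameters (it is always invertible). Let $J$ be a symmetric positive definite inertia matrix, let $K_m,\Lambda_m\in\mathbb R^{3\times3}$ be constant matrices with positive definite quadratic form, let $K_I(t)$, $t\ge0$, be diagonal and differentiable with $K_I(t)\succeq\kappa I$ for some $\kappa>0$ and $\dot K_I(t)\succeq 0$ (in particular $K_I$ may be constant, or $\dot K_I$ may be uniformly positive definite), and let $q_d$ be a $C^2$ desired trajectory with $q_d,\dot q_d$ bounded on $[0,\infty)$. Let $\hat q,\hat\omega,\hat J$ be the measured attitude, the measured angular velocity and the estimated inertia (exact knowledge, $\hat\omega=\omega$, $\hat J=J$, is allowed), and consider any solution on $[0,\infty)$ of $$\dot{\hat q}=Z(\hat q)\hat\omega,\qquad J\dot\omega=(J\omega)\times\omega+u_c+d_{\rm ext},$$ $$u_c=\hat J\dot\omega_r-S(\hat J\hat\omega)\omega_r-K_m\omega_e-\int_0^tK_I\,\omega_e\,ds,\qquad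 \omega_r=Z^{-1}(\hat q)\dot q_d+Z^{-1}(\hat q)\Lambda_m(q_d-\hat q),\qquad \omega_e=\hat\omega-\omega_r .$$ With $\Delta J=J-\hat J$ and $\Delta\omega=\omega-\hat\omega$ put $$d=d_{\rm res,2}=(J\Delta\omega)\times\hat\omega+(J\omega)\times\Delta\omega-J\Delta\dot\omega+d_{\rm ext}-\Delta J\,\dot\omega_r+S(\Delta J\hat\omega)\omega_r ,\qquad q_e=\hat q-q_d .$$ Below, $\zeta$ denotes any number with $\sup_{t\ge0}\sigma_{\max}(Z(\hat q(t)))\le\zeta$; assertions on $q_e$ are made for solutions for which such a $\zeta$ exists. All constants depend only on $J,K_m,\Lambda_m,K_I,q_d$ and the parameters named. (i) *Constant disturbance.* There is $\lambda>0$ such that for every $r$ there is $C\ge0$ such that for every solution with $d\equiv c$ constant and $x_0:=\|\omega_e(0)\|+\|c\|\le r$, for all $t\ge0$, $$\|\omega_e(t)\|\le Ce^{-\lambda t}x_0,\qquad \|q_e(t)\|\le e^{-\lambda t}\big(\|q_e(0)\|+C\zeta x_0\big).$$ Moreover, a bound $\zeta$ exists for every such solution unless $\|\hat q(t)\|\to\infty$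 as $t\to\infty$ (i.e. unless the attitude tends to the singularity of the parametrization). (ii) *Time-varying disturbance with bounded rate.* (a) For all $r,D_0$ there is $W$ such that every solution with $\|\omega_e(0)\|\le r$ and $\|d(t)\|\le D_0$ for all $t\ge 0$ satisfies $\|\hat\omega(t)\|\le W$ for all $t\ge0$. (b) For every $W$ there are $\lambda,C,\gamma>0$ such that every solution with $\sup_t\|\hat\omega(t)\|\le W$ and $d$ differentiable satisfies, with $x_0:=\|\omega_e(0)\|+\|d(0)\|$ and for all $T\ge 0$ and all $D$ with $\|\dot d\|\le D$ on $[0,T]$ (input-to-state stability), $$\|\omega_e(T)\|\le Ce^{-\lambda T}x_0+\gamma D,\qquad \|q_e(T)\|\le e^{-\lambda T}\big(\|q_e(0)\|+C\zeta x_0\big)+\gamma\zeta D,$$ and, for all $p\in[1,\infty]$ and $T\ge0$ (finite-gain $\mathcal L_p$ stability), $$\|\omega_e\|_{L_p[0,T]}\le Cx_0+\gamma\|\dot d\|_{L_p[0,T]},\qquad \|q_e\|_{L_p[0,T]}\le C\big(\|q_e(0)\|+\zeta x_0\big)+\gamma\zeta\|\dot d\|_{L_p[0,T]} .$$ (c)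 For every $D_0$ there are $\lambda,\gamma>0$ such that for every $r$ there is $C\ge0$ such that every solution with $\|\omega_e(0)\|\le r$, $d$ differentiable, $\|d(t)\|\le D_0$ and $\|\dot d(t)\|\le D$ for all $t\ge0$ satisfies, for all $t\ge0$, $$\|\omega_e(t)\|\le Ce^{-\lambda t}+\gamma D,\qquad \|q_e(t)\|\le e^{-\lambda t}\big(\|q_e(0)\|+C\zeta\big)+\gamma\zeta D ,$$ so the errors converge exponentially to balls of radius proportional to $\sup_t\|\dot d\|$. -/

import Mathlib

open MeasureTheory Set Filter
open scoped ENNReal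

noncomputable section

/-- Euclidean three-space (with the 2-norm). -/
abbrev V3 : Type := EuclideanSpace ℝ (Fin 3)

/-- Real 3×3 matrices. -/
abbrev M3 : Type := Matrix (Fin 3) (Fin 3) ℝ

/-- Matrix-vector product on Euclidean three-space. -/
def mv (A : M3) (v : V3) : V3 := Matrix.toEuclideanCLM (n := Fin 3) (𝕜 := ℝ) A v

/-- Largest singular value: the operator norm induced by the Euclidean norm. -/
def sigmaMax (A : M3) : ℝ := ‖Matrix.toEuclideanCLM (n := Fin 3) (𝕜 := ℝ) A‖

/-- Positive definiteness of the quadratic form of a (not necessarily symmetric) matrix. -/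
def PosDefForm (A : M3) : Prop := ∀ x : V3, x ≠ 0 → 0 < inner ℝ x (mv A x)

/-- The skew-symmetric matrix `S(v)`, with `S(v) b = v × b`. -/
def skew (v : V3) : M3 :=
  !![0, -v 2, v 1;
     v 2, 0, -v 0;
     -v 1, v 0, 0]

theorem mv_apply (A : M3) (v : V3) (i : Fin 3) : mv A v i = ∑ j, A i j * v j := rfl

theorem mv_skew (a b : V3) :
    mv (skew a) b = WithLp.toLp 2 (crossProduct a.ofLp b.ofLp) := by
  ext i
  fin_cases i <;> simp [mv_apply, skew, Fin.sum_univ_three, cross_apply] <;> ring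

/-- The kinematic matrix of the modified Rodrigues parameters,
`Z(q) = ½ (((1 - qᵀq)/2) I + q qᵀ + S(q))`. -/
def mrpZ (q : V3) : M3 :=
  (1 / 2 : ℝ) •
    (((1 - ‖q‖ ^ 2) / 2) • (1 : M3) + Matrix.vecMulVec q.ofLp q.ofLp + skew q)

/-- Reference angular velocity `ω_r = Z⁻¹(q̂) q̇_d + Z⁻¹(q̂) Λ (q_d - q̂)`. -/
def omegaR (Lam : M3) (qd qh : ℝ → V3) (t : ℝ) : V3 :=
  mv (mrpZ (qh t))⁻¹ (deriv qd t) + mv (mrpZ (qh t))⁻¹ (mv Lam (qd t - qh t))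

/-- Composite angular velocity error `ω_e = ω̂ - ω_r`. -/
def omegaE (Lam : M3) (qd qh wh : ℝ → V3) (t : ℝ) : V3 :=
  wh t - omegaR Lam qd qh t

/-- The attitude control law with integral term
`u = Ĵ ω̇_r - S(Ĵ ω̂) ω_r - K_m (ω̂ - ω_r) - ∫₀ᵗ K_I (ω̂ - ω_r) ds`. -/
def controlLaw (Jh Km Lam : M3) (KI : ℝ → M3) (qd qh wh : ℝ → V3) (t : ℝ) : V3 :=
  mv Jh (deriv (omegaR Lam qd qh) t)
    - mv (skew (mv Jh (wh t))) (omegaR Lam qd qh t)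
    - mv Km (omegaE Lam qd qh wh t)
    - ∫ s in (0 : ℝ)..t, mv (KI s) (omegaE Lam qd qh wh s)

/-- `(q̂, ω, ω̂)` is a trajectory on `[0, ∞)` of the attitude kinematics (for the measured
attitude `q̂` and the measured angular velocity `ω̂`) and of the attitude dynamics
`J ω̇ = (J ω) × ω + u + d_ext` (for the true angular velocity `ω`), in closed loop with the
integral control law.  Exact measurements are the case `ω̂ = ω`. -/
structure ClosedLoop (J Jh Km Lam : M3) (KI : ℝ → M3) (qd qh w wh dext : ℝ → V3) : Prop where
  kinematics : ∀ t, 0 ≤ t → HasDerivAt qh (mv (mrpZ (qh t)) (wh t)) t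
  diff_w : ∀ t, 0 ≤ t → DifferentiableAt ℝ w t
  diff_wh : ∀ t, 0 ≤ t → DifferentiableAt ℝ wh t
  dynamics : ∀ t, 0 ≤ t →
    mv J (deriv w t) =
      mv (skew (mv J (w t))) (w t) + controlLaw Jh Km Lam KI qd qh wh t + dext t

/-- Disturbance from the external torque and the angular velocity measurement error
`Δω = ω - ω̂`:  `d_res = (J Δω) × ω̂ + (J ω) × Δω - J Δω̇ + d_ext`. -/
def dRes (J : M3) (w wh dext : ℝ → V3) (t : ℝ) : V3 :=
  mv (skew (mv J (w t - wh t))) (wh t) + mv (skew (mv J (w t))) (w t - wh t)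
    - mv J (deriv (fun s => w s - wh s) t) + dext t

/-- Resultant disturbance, including the inertia error `ΔJ = J - Ĵ`:
`d_res,2 = d_res - ΔJ ω̇_r + S(ΔJ ω̂) ω_r`. -/
def dRes2 (J Jh Lam : M3) (qd qh w wh dext : ℝ → V3) (t : ℝ) : V3 :=
  dRes J w wh dext t - mv (J - Jh) (deriv (omegaR Lam qd qh) t)
    + mv (skew (mv (J - Jh) (wh t))) (omegaR Lam qd qh t)

end

/-! Substituting the control law gives the error equation `J ė = S(J ω̂) e - K_m e - y + d`, `ẏ =
K_I e`, with `y` the integral state. Replacing `y` by `z = y - d` removes `d` and leaves only its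
rate: `ż = K_I e - ḋ`. The energy `V = ½ eᵀJe + ½ zᵀK_I⁻¹z` dissipates `e` but not `z`; adding a
small multiple `ε` of the cross term `X = zᵀK_I⁻¹Je` supplies the missing `-zᵀK_I⁻¹z`.

No bound on `K̇_I` is available, so the terms it produces in `Ẋ` have to be absorbed by sign.
Young's inequality splits them into a part cancelled by the dissipation `-½ zᵀK_I⁻¹K̇_I K_I⁻¹z` of
`V` and a part `β‖Je‖²/2`, where `-β` is the derivative of `tr K_I⁻¹`. The latter is cancelled by
weighting `V` with `1 + a tr K_I⁻¹`, a bounded and nonincreasing factor. For `‖ω̂‖ ≤ W` this yields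
`Ḟ ≤ -2λF + 2√F γ‖ḋ‖` (`exists_lyapunov`), hence a linear inequality for `√F`, which gives both
input-to-state and `L^p` estimates.

To remove the a priori bound on `ω̂`, note that `‖Z⁻¹(q)v‖ = 4‖v‖/(1+‖q‖²)`, so `ω_r` is bounded by
some `R` and `‖ω̂‖ ≤ ‖e‖ + R`. The cross term then contains a cubic contribution, which is dominated
by the dissipation of the power `((1 + a tr K_I⁻¹)(1 + V))^{3/2}` (`exists_ultimate_lyapunov`).
Above a level depending on the disturbance bound but not on the initial state, the resulting
function decreases at unit rate. After a transient whose length depends on `r`, the angular velocity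
obeys a bound independent of `r`; the decay rate is therefore uniform and the transient only enters
`C`.

The attitude error obeys `q̇_e = Z(q̂) e - Λ q_e`, a stable linear filter with input of size at most
`ζ‖e‖`, so every estimate for `e` passes to `q_e`. -/

/-! ### Scalar differential inequalities. -/

theorem image_le_of_hasDerivAt_nonpos {f f' : ℝ → ℝ} {a b : ℝ} (hab : a ≤ b)
    (hf : ContinuousOn f (Icc a b)) (hf' : ∀ t ∈ Ioo a b, HasDerivAt f (f' t) t)
    (hle : ∀ t ∈ Ioo a b, f' t ≤ 0) : f b ≤ f a := by
  have : AntitoneOn f (Icc a b) := by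
    apply antitoneOn_of_deriv_nonpos (convex_Icc a b) hf
    · intro t ht
      rw [interior_Icc] at ht
      exact (hf' t ht).differentiableAt.differentiableWithinAt
    · intro t ht
      rw [interior_Icc] at ht
      rw [(hf' t ht).deriv]
      exact hle t ht
  exact this (left_mem_Icc.2 hab) (right_mem_Icc.2 hab) hab

/-- Gronwall estimate for a linear differential inequality with exponentially decaying input. -/
theorem linear_comparison {u u' : ℝ → ℝ} {a b lam mu A D : ℝ} (hab : a ≤ b) (hlam : 0 < lam)
    (hmu : mu < lam) (hu : ContinuousOn u (Icc a b))
    (hu' : ∀ t ∈ Ioo a b, HasDerivAt u (u' t) t)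
    (hle : ∀ t ∈ Ioo a b, u' t ≤ -lam * u t + (A * Real.exp (-mu * (t - a)) + D)) (hA : 0 ≤ A)
    (hD : 0 ≤ D) :
    u b ≤ Real.exp (-lam * (b - a)) * u a + A / (lam - mu) * Real.exp (-mu * (b - a))
      + D / lam := by
  have h1 : 0 < lam - mu := sub_pos.2 hmu
  -- The subtracted terms form a particular solution of the comparison equation, so `exp (lam * (t -
  -- a)) * v t` is nonincreasing.
  set v : ℝ → ℝ := fun t => u t - A / (lam - mu) * Real.exp (-mu * (t - a)) - D / lam with hv
  have hE : ∀ c t : ℝ, HasDerivAt (fun s => Real.exp (c * (s - a)))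
      (Real.exp (c * (t - a)) * c) t := by
    intro c t
    have : HasDerivAt (fun s => c * (s - a)) c t := by
      simpa using ((hasDerivAt_id t).sub_const a).const_mul c
    exact this.exp
  have key : Real.exp (lam * (b - a)) * v b ≤ Real.exp (lam * (a - a)) * v a := by
    apply image_le_of_hasDerivAt_nonpos (f := fun t => Real.exp (lam * (t - a)) * v t) hab
    · apply ContinuousOn.mul (by fun_prop)
      exact (hu.sub (by fun_prop)).sub (by fun_prop)
    · intro t ht
      exact (hE lam t).mul (((hu' t ht).sub ((hE (-mu) t).const_mul (A / (lam - mu)))).sub_const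
        (D / lam))
    · intro t ht
      have h2 := hle t ht
      have h3 := Real.exp_pos (lam * (t - a))
      have h4 : Real.exp (lam * (t - a)) * lam * v t + Real.exp (lam * (t - a)) *
          (u' t - A / (lam - mu) * (Real.exp (-mu * (t - a)) * -mu)) =
          Real.exp (lam * (t - a)) *
            (u' t - (-lam * u t + (A * Real.exp (-mu * (t - a)) + D))) := by
        simp only [hv]; field_simp; ring
      rw [h4]
      exact mul_nonpos_of_nonneg_of_nonpos h3.le (by linarith)
  have h5 : v b ≤ Real.exp (-lam * (b - a)) * v a := by
    have h6 : Real.exp (lam * (b - a)) * Real.exp (-lam * (b - a)) = 1 := by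
      rw [← Real.exp_add]; simp
    have h7 := mul_le_mul_of_nonneg_left key (Real.exp_pos (-lam * (b - a))).le
    rw [← mul_assoc, mul_comm (Real.exp (-lam * (b - a))), h6, one_mul] at h7
    simpa using h7
  have h8 : v a ≤ u a := by
    simp only [hv]
    have : 0 ≤ A / (lam - mu) * Real.exp (-mu * (a - a)) := by positivity
    have : 0 ≤ D / lam := by positivity
    linarith
  have h9 := mul_le_mul_of_nonneg_left h8 (Real.exp_pos (-lam * (b - a))).le
  simp only [hv] at h5 h9
  linarith

/-- Regularised square root of an energy satisfying a quadratic differential inequality. -/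
theorem hasDerivAt_sqrt_add_sq {F : ℝ → ℝ} {F' t lam g eta : ℝ} (hF : HasDerivAt F F' t)
    (h0 : 0 ≤ F t) (hg : 0 ≤ g) (heta : 0 < eta) (hlam : 0 ≤ lam)
    (hle : F' ≤ -(2 * lam) * F t + 2 * Real.sqrt (F t) * g) :
    HasDerivAt (fun s => Real.sqrt (F s + eta ^ 2)) (F' / (2 * Real.sqrt (F t + eta ^ 2))) t ∧
      F' / (2 * Real.sqrt (F t + eta ^ 2)) ≤
        -lam * Real.sqrt (F t + eta ^ 2) + (g + lam * eta) := by
  have hpos : 0 < F t + eta ^ 2 := by positivity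
  refine ⟨(hF.add_const (eta ^ 2)).sqrt hpos.ne', ?_⟩
  set u := Real.sqrt (F t + eta ^ 2) with hu
  have hu0 : 0 < u := Real.sqrt_pos.2 hpos
  have huu : u ^ 2 = F t + eta ^ 2 := Real.sq_sqrt hpos.le
  have hue : eta ≤ u := Real.le_sqrt_of_sq_le (by linarith)
  have huF : Real.sqrt (F t) ≤ u := Real.sqrt_le_sqrt (by nlinarith)
  -- Since `F = u² - η²`, the decay term leaves an excess `2λη²`, and `η ≤ u` turns it into the loss
  -- `λη` in the linear inequality.
  rw [div_le_iff₀ (by positivity)]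
  have h1 : Real.sqrt (F t) * g ≤ u * g := mul_le_mul_of_nonneg_right huF hg
  have h2 : lam * (eta * eta) ≤ lam * (eta * u) :=
    mul_le_mul_of_nonneg_left (mul_le_mul_of_nonneg_left hue heta.le) hlam
  nlinarith

theorem sqrt_add_sq_le {x eta : ℝ} (hx : 0 ≤ x) (heta : 0 ≤ eta) :
    Real.sqrt (x + eta ^ 2) ≤ Real.sqrt x + eta := by
  apply Real.sqrt_le_iff.2 ⟨by positivity, ?_⟩
  nlinarith [Real.sq_sqrt hx, mul_nonneg (Real.sqrt_nonneg x) heta]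

/-- The square root need not be differentiable where `F` vanishes. The linear comparison is
therefore applied to `√(F + η²)`, with `λη` added to the input, and `η` is then made arbitrarily
small. -/
theorem sqrt_comparison {F F' g : ℝ → ℝ} {a b lam mu A D : ℝ} (hab : a ≤ b) (hlam : 0 < lam)
    (hmu : mu < lam) (hF : ContinuousOn F (Icc a b))
    (hF' : ∀ t ∈ Ioo a b, HasDerivAt F (F' t) t) (h0 : ∀ t ∈ Icc a b, 0 ≤ F t)
    (hle : ∀ t ∈ Ioo a b, F' t ≤ -(2 * lam) * F t + 2 * Real.sqrt (F t) * g t)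
    (hg0 : ∀ t ∈ Ioo a b, 0 ≤ g t)
    (hg : ∀ t ∈ Ioo a b, g t ≤ A * Real.exp (-mu * (t - a)) + D) (hA : 0 ≤ A) (hD : 0 ≤ D) :
    Real.sqrt (F b) ≤ Real.exp (-lam * (b - a)) * Real.sqrt (F a)
      + A / (lam - mu) * Real.exp (-mu * (b - a)) + D / lam := by
  apply le_of_forall_pos_le_add
  intro ε hε
  have heta : 0 < ε / 2 := by positivity
  have h := linear_comparison (u := fun s => Real.sqrt (F s + (ε / 2) ^ 2))
    (D := D + lam * (ε / 2)) (A := A) (mu := mu) hab hlam hmu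
    (Real.continuous_sqrt.comp_continuousOn (hF.add continuousOn_const))
    (fun t ht => (hasDerivAt_sqrt_add_sq (hF' t ht) (h0 t (Ioo_subset_Icc_self ht)) (hg0 t ht)
      heta hlam.le (hle t ht)).1)
    (fun t ht => by
      have h1 := (hasDerivAt_sqrt_add_sq (hF' t ht) (h0 t (Ioo_subset_Icc_self ht)) (hg0 t ht)
        heta hlam.le (hle t ht)).2
      have h2 := hg t ht
      linarith) hA (by positivity)
  have h1 : Real.sqrt (F b) ≤ Real.sqrt (F b + (ε / 2) ^ 2) :=
    Real.sqrt_le_sqrt (by nlinarith)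
  have h2 := sqrt_add_sq_le (h0 a (left_mem_Icc.2 hab)) heta.le
  have h3 : Real.exp (-lam * (b - a)) ≤ 1 := by
    apply Real.exp_le_one_iff.2
    nlinarith
  have h4 : (D + lam * (ε / 2)) / lam = D / lam + ε / 2 := by field_simp
  have h5 := Real.exp_pos (-lam * (b - a))
  simp only [h4] at h
  nlinarith [mul_le_mul_of_nonneg_left h2 h5.le]

/-- If `L` decreases at unit rate above the level `m`, it enters and stays below `m`. -/
theorem le_max_of_hasDerivAt_le_neg_one {L L' : ℝ → ℝ} {m : ℝ} (hL : ContinuousOn L (Ici 0))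
    (hL' : ∀ t, 0 < t → HasDerivAt L (L' t) t) (h : ∀ t, 0 < t → m < L t → L' t ≤ -1) {t : ℝ}
    (ht : 0 ≤ t) : L t ≤ max m (L 0 - t) := by
  by_contra! hlt
  obtain ⟨h1, h2⟩ := max_lt_iff.1 hlt
  by_cases hall : ∀ s ∈ Icc 0 t, m < L s
  -- If `L` never reached the level `m`, then `L s + s` is nonincreasing on the whole interval.
  · have := image_le_of_hasDerivAt_nonpos (f := fun s => L s + s) ht
      ((hL.mono Icc_subset_Ici_self).add continuousOn_id)
      (fun s hs => (hL' s hs.1).add (hasDerivAt_id s))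
      (fun s hs => by linarith [h s hs.1 (hall s (Ioo_subset_Icc_self hs))])
    simp only [add_zero] at this
    linarith
  · push Not at hall
    obtain ⟨s, hs, hsm⟩ := hall
    -- Otherwise take the last time at which `L ≤ m`; after it `L` exceeds `m` and hence decreases,
    -- so it cannot end above `m`.
    set S := {x ∈ Icc s t | L x ≤ m} with hS
    have hcont : ContinuousOn L (Icc s t) := hL.mono fun x hx => hs.1.trans hx.1
    have hcl : IsClosed S := hcont.preimage_isClosed_of_isClosed isClosed_Icc isClosed_Iic
    have hne : S.Nonempty := ⟨s, ⟨le_rfl, hs.2⟩, hsm⟩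
    have hbdd : BddAbove S := ⟨t, fun x hx => hx.1.2⟩
    obtain ⟨hτ, hτm⟩ := hcl.csSup_mem hne hbdd
    set τ := sSup S
    have hτ0 : 0 ≤ τ := hs.1.trans hτ.1
    have := image_le_of_hasDerivAt_nonpos (f := L) hτ.2
      (hcont.mono (Icc_subset_Icc_left hτ.1)) (fun x hx => hL' x (hτ0.trans_lt hx.1))
      (fun x hx => by
        have hx0 := hτ0.trans_lt hx.1
        by_cases hm : m < L x
        · linarith [h x hx0 hm]
        · exact absurd (le_csSup hbdd ⟨⟨hτ.1.trans hx.1.le, hx.2.le⟩, not_lt.1 hm⟩)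
            (not_le.2 hx.1))
    linarith

/-! ### Finite-gain `L^p` estimates on a bounded interval. -/

/-- Weighted arithmetic-geometric mean with weights `1 - 1/p` and `1/p`. The coefficient `p - 1` is
what matters: in the estimate of `d(u^p)/dt` exactly one copy of `λ u^p` survives, for every `p`. -/
theorem rpow_young {u h p : ℝ} (hu : 0 < u) (hh : 0 ≤ h) (hp : 1 ≤ p) :
    p * u ^ (p - 1) * h ≤ (p - 1) * u ^ p + h ^ p := by
  have hp0 : 0 < p := by linarith
  have h1 := Real.geom_mean_le_arith_mean2_weighted (w₁ := 1 - 1 / p) (w₂ := 1 / p)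
    (p₁ := u ^ p) (p₂ := h ^ p) (by rw [sub_nonneg, div_le_one hp0]; exact hp)
    (by positivity) (by positivity) (by positivity) (by ring)
  rw [← Real.rpow_mul hu.le, ← Real.rpow_mul hh] at h1
  have e1 : p * (1 - 1 / p) = p - 1 := by field_simp
  have e2 : p * (1 / p) = 1 := by field_simp
  rw [e1, e2, Real.rpow_one] at h1
  have h2 := mul_le_mul_of_nonneg_left h1 hp0.le
  have e3 : p * ((1 - 1 / p) * u ^ p + 1 / p * h ^ p) = (p - 1) * u ^ p + h ^ p := by
    field_simp
  rw [e3] at h2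
  linarith

/-- `L^p` energy inequality, with constants uniform in `p`. -/
theorem integral_rpow_le {u u' g : ℝ → ℝ} {a b lam p : ℝ} (hab : a ≤ b) (hlam : 0 < lam)
    (hp : 1 ≤ p) (hu : ContinuousOn u (Icc a b)) (hpos : ∀ t ∈ Icc a b, 0 < u t)
    (hg : ∀ t, 0 ≤ g t) (hu' : ∀ t ∈ Ioo a b, HasDerivAt u (u' t) t)
    (hle : ∀ t ∈ Ioo a b, u' t ≤ -lam * u t + g t)
    (hint : IntegrableOn (fun t => g t ^ p) (Icc a b)) :
    ∫ t in Icc a b, u t ^ p ≤ u a ^ p / lam + (1 / lam) ^ p * ∫ t in Icc a b, g t ^ p := by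
  have hp0 : 0 < p := by linarith
  have hup : ContinuousOn (fun t => u t ^ p) (Icc a b) :=
    hu.rpow_const fun t ht => Or.inl (hpos t ht).ne'
  have hupi : IntegrableOn (fun t => u t ^ p) (Icc a b) := hup.integrableOn_Icc
  have key := intervalIntegral.sub_le_integral_of_hasDeriv_right_of_le
    (g := fun t => u t ^ p) (g' := fun t => u' t * p * u t ^ (p - 1))
    (φ := fun t => -lam * u t ^ p + lam * (1 / lam) ^ p * g t ^ p) hab hup
    (fun t ht => ((hu' t ht).rpow_const
      (Or.inl (hpos t (Ioo_subset_Icc_self ht)).ne')).hasDerivWithinAt)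
    ((hupi.const_mul _).add (hint.const_mul _))
    (fun t ht => by
      have h0 := hpos t (Ioo_subset_Icc_self ht)
      have h1 := rpow_young h0 (div_nonneg (hg t) hlam.le) hp
      have h2 : (g t / lam) ^ p = (1 / lam) ^ p * g t ^ p := by
        rw [← Real.mul_rpow (by positivity) (hg t)]; congr 1; ring
      have h3 : u t ^ (p - 1) * u t = u t ^ p := by
        rw [← Real.rpow_add_one h0.ne']; congr 1; ring
      have h4 : u' t * (p * u t ^ (p - 1)) ≤ (-lam * u t + g t) * (p * u t ^ (p - 1)) :=
        mul_le_mul_of_nonneg_right (hle t ht) (by positivity)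
      have h5 : (-lam * u t + g t) * (p * u t ^ (p - 1)) =
          lam * (p * u t ^ (p - 1) * (g t / lam)) - lam * p * u t ^ p := by
        rw [← h3]; field_simp; ring
      rw [h2] at h1
      have h6 := mul_le_mul_of_nonneg_left h1 hlam.le
      nlinarith)
  rw [intervalIntegral.integral_of_le hab, ← integral_Icc_eq_integral_Ioc,
    integral_add (hupi.const_mul _) (hint.const_mul _), integral_const_mul,
    integral_const_mul] at key
  have h7 : 0 ≤ u b ^ p := Real.rpow_nonneg (hpos b (right_mem_Icc.2 hab)).le p
  have h8 : lam * ∫ t in Icc a b, u t ^ p ≤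
      u a ^ p + lam * ((1 / lam) ^ p * ∫ t in Icc a b, g t ^ p) := by
    linarith
  have h9 : u a ^ p / lam + (1 / lam) ^ p * ∫ t in Icc a b, g t ^ p =
      (u a ^ p + lam * ((1 / lam) ^ p * ∫ t in Icc a b, g t ^ p)) / lam := by
    field_simp
  rw [h9, le_div_iff₀ hlam]
  linarith

/-- Bounds the factor `(1/λ)^{1/p}` independently of `p`. -/
theorem rpow_one_div_le {x p : ℝ} (hx : 0 ≤ x) (hp : 1 ≤ p) : x ^ p⁻¹ ≤ 1 + x := by
  rcases le_total x 1 with h | h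
  · have := Real.rpow_le_one hx h (inv_nonneg.2 (by linarith : (0 : ℝ) ≤ p))
    linarith
  · have := Real.rpow_le_rpow_of_exponent_le h (inv_le_one_of_one_le₀ hp)
    rw [Real.rpow_one] at this
    linarith

/-- Finite-gain `L^p` estimate for a scalar linear differential inequality. -/
theorem eLpNorm_le_of_linear {u u' g : ℝ → ℝ} {a b lam : ℝ} {p : ℝ≥0∞} (hab : a ≤ b)
    (hlam : 0 < lam) (hp : 1 ≤ p) (hu : ContinuousOn u (Icc a b))
    (hpos : ∀ t ∈ Icc a b, 0 < u t) (hg : ∀ t, 0 ≤ g t)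
    (hgm : AEStronglyMeasurable g (volume.restrict (Icc a b)))
    (hu' : ∀ t ∈ Ioo a b, HasDerivAt u (u' t) t)
    (hle : ∀ t ∈ Ioo a b, u' t ≤ -lam * u t + g t) :
    eLpNorm u p (volume.restrict (Icc a b)) ≤ ENNReal.ofReal ((1 + 1 / lam) * u a)
      + ENNReal.ofReal (1 / lam) * eLpNorm g p (volume.restrict (Icc a b)) := by
  have hua : 0 < u a := hpos a (left_mem_Icc.2 hab)
  by_cases hgtop : eLpNorm g p (volume.restrict (Icc a b)) = ∞
  · rw [hgtop, ENNReal.mul_top (by simpa using hlam)]; simp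
  have hgL : MemLp g p (volume.restrict (Icc a b)) := ⟨hgm, lt_top_iff_ne_top.2 hgtop⟩
  have hum : AEStronglyMeasurable u (volume.restrict (Icc a b)) :=
    hu.aestronglyMeasurable measurableSet_Icc
  by_cases hptop : p = ∞
  -- For `p = ∞` the energy argument is replaced by variation of constants, with integrating factor
  -- `exp (lam * t)` and an almost everywhere bound on the input.
  · subst hptop
    set D := (eLpNorm g ∞ (volume.restrict (Icc a b))).toReal with hD
    have hgD : ∀ᵐ t ∂(volume.restrict (Icc a b)), g t ≤ D := by
      filter_upwards [ae_le_eLpNormEssSup (f := g) (μ := volume.restrict (Icc a b))] with t ht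
      rw [← eLpNorm_exponent_top] at ht
      have := ENNReal.toReal_mono hgtop ht
      simpa only [toReal_enorm, Real.norm_of_nonneg (hg t)] using this
    have hgi : IntegrableOn g (Icc a b) := (hgL.mono_exponent le_top).integrable le_rfl
    have hbound : ∀ t ∈ Icc a b, u t ≤ (1 + 1 / lam) * u a + 1 / lam * D := by
      intro T hT
      have hsub : Icc a T ⊆ Icc a b := Icc_subset_Icc_right hT.2
      have hE : Continuous fun t => Real.exp (lam * t) := by fun_prop
      have hgi' : IntegrableOn (fun t => Real.exp (lam * t) * g t) (Icc a T) :=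
        (hgi.mono_set hsub).continuousOn_mul hE.continuousOn isCompact_Icc
      have hd : ∀ t, HasDerivAt (fun s => Real.exp (lam * s)) (Real.exp (lam * t) * lam) t :=
        fun t => by simpa using ((hasDerivAt_id t).const_mul lam).exp
      have key := intervalIntegral.sub_le_integral_of_hasDeriv_right_of_le
        (g := fun t => Real.exp (lam * t) * u t)
        (φ := fun t => Real.exp (lam * t) * g t) hT.1
        (hE.continuousOn.mul (hu.mono hsub))
        (fun t ht => ((hd t).mul (hu' t ⟨ht.1, ht.2.trans_le hT.2⟩)).hasDerivWithinAt) hgi'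
        (fun t ht => by
          have h1 := mul_le_mul_of_nonneg_left (hle t ⟨ht.1, ht.2.trans_le hT.2⟩)
            (Real.exp_pos (lam * t)).le
          nlinarith)
      rw [intervalIntegral.integral_of_le hT.1, ← integral_Icc_eq_integral_Ioc] at key
      have h2 : ∫ t in Icc a T, Real.exp (lam * t) * g t ≤
          ∫ t in Icc a T, Real.exp (lam * t) * D := by
        apply setIntegral_mono_ae_restrict hgi'
          ((hE.mul continuous_const).continuousOn.integrableOn_Icc)
        filter_upwards [ae_restrict_of_ae_restrict_of_subset hsub hgD] with t ht
        exact mul_le_mul_of_nonneg_left ht (Real.exp_pos _).le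
      have h3 : ∫ t in Icc a T, Real.exp (lam * t) * D =
          (Real.exp (lam * T) - Real.exp (lam * a)) * (D / lam) := by
        rw [integral_Icc_eq_integral_Ioc, ← intervalIntegral.integral_of_le hT.1]
        rw [intervalIntegral.integral_eq_sub_of_hasDerivAt
          (f := fun t => Real.exp (lam * t) * (D / lam))]
        · ring
        · intro t _
          have := (hd t).mul_const (D / lam)
          rwa [mul_assoc, mul_div_cancel₀ _ hlam.ne'] at this
        · exact (hE.mul continuous_const).intervalIntegrable _ _
      rw [h3] at h2
      have hD0 : 0 ≤ D / lam := div_nonneg ENNReal.toReal_nonneg hlam.le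
      have h4 : Real.exp (lam * a) ≤ Real.exp (lam * T) :=
        Real.exp_le_exp.2 (mul_le_mul_of_nonneg_left hT.1 hlam.le)
      have h5 : Real.exp (lam * T) * u T ≤ Real.exp (lam * T) * (u a + D / lam) := by
        nlinarith [Real.exp_pos (lam * a)]
      have h6 := le_of_mul_le_mul_left h5 (Real.exp_pos _)
      have h7 : 0 ≤ 1 / lam * u a := by positivity
      have h8 : 1 / lam * D = D / lam := by ring
      nlinarith
    have hR : ENNReal.ofReal ((1 + 1 / lam) * u a) + ENNReal.ofReal (1 / lam) *
        eLpNorm g ∞ (volume.restrict (Icc a b)) =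
        ENNReal.ofReal ((1 + 1 / lam) * u a + 1 / lam * D) := by
      rw [ENNReal.ofReal_add (by positivity)
        (mul_nonneg (by positivity) ENNReal.toReal_nonneg), ENNReal.ofReal_mul (by positivity),
        ENNReal.ofReal_mul (p := 1 / lam) (by positivity), ENNReal.ofReal_toReal hgtop]
    rw [hR, eLpNorm_exponent_top]
    apply eLpNormEssSup_le_of_ae_bound
    filter_upwards [ae_restrict_mem measurableSet_Icc] with t ht
    rw [Real.norm_of_nonneg (hpos t ht).le]
    exact hbound t ht
  · have hp0 : p ≠ 0 := (zero_lt_one.trans_le hp).ne'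
    have hp1 : 1 ≤ p.toReal := by
      have := ENNReal.toReal_mono hptop hp
      simpa using this
    have huL : MemLp u p (volume.restrict (Icc a b)) := by
      obtain ⟨B, hB⟩ := isCompact_Icc.exists_bound_of_continuousOn hu
      apply MemLp.of_bound hum B
      filter_upwards [ae_restrict_mem measurableSet_Icc] with t ht
      exact hB t ht
    have hgi := hgL.integrable_norm_rpow hp0 hptop
    simp only [Real.norm_of_nonneg (hg _)] at hgi
    have key := integral_rpow_le hab hlam hp1 hu hpos hg hu' hle hgi
    rw [huL.eLpNorm_eq_integral_rpow_norm hp0 hptop, hgL.eLpNorm_eq_integral_rpow_norm hp0 hptop]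
    simp only [Real.norm_of_nonneg (hg _)]
    have e1 : ∫ t in Icc a b, ‖u t‖ ^ p.toReal = ∫ t in Icc a b, u t ^ p.toReal :=
      setIntegral_congr_fun measurableSet_Icc fun t ht => by
        simp only [Real.norm_of_nonneg (hpos t ht).le]
    have hI : 0 ≤ ∫ t in Icc a b, g t ^ p.toReal :=
      integral_nonneg fun t => Real.rpow_nonneg (hg t) _
    have hI' : 0 ≤ ∫ t in Icc a b, u t ^ p.toReal := by
      rw [← e1]; exact integral_nonneg fun t => Real.rpow_nonneg (norm_nonneg _) _
    rw [e1, ← ENNReal.ofReal_mul (by positivity), ← ENNReal.ofReal_add (by positivity)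
      (by positivity)]
    apply ENNReal.ofReal_le_ofReal
    have hq0 : 0 ≤ p.toReal⁻¹ := by positivity
    calc (∫ t in Icc a b, u t ^ p.toReal) ^ p.toReal⁻¹
        ≤ (u a ^ p.toReal / lam + (1 / lam) ^ p.toReal * ∫ t in Icc a b, g t ^ p.toReal)
            ^ p.toReal⁻¹ := Real.rpow_le_rpow hI' key hq0
      _ ≤ (u a ^ p.toReal / lam) ^ p.toReal⁻¹ +
            ((1 / lam) ^ p.toReal * ∫ t in Icc a b, g t ^ p.toReal) ^ p.toReal⁻¹ :=
          Real.rpow_add_le_add_rpow (by positivity) (by positivity) hq0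
            (inv_le_one_of_one_le₀ hp1)
      _ = (1 / lam) ^ p.toReal⁻¹ * u a +
            1 / lam * (∫ t in Icc a b, g t ^ p.toReal) ^ p.toReal⁻¹ := by
          rw [Real.mul_rpow (by positivity) hI, Real.rpow_rpow_inv (by positivity) (by positivity),
            div_eq_mul_one_div, Real.mul_rpow (by positivity) (by positivity),
            Real.rpow_rpow_inv hua.le (by positivity), mul_comm (u a)]
      _ ≤ _ := by
          gcongr
          exact rpow_one_div_le (by positivity) hp1

/-- Same regularisation as in `sqrt_comparison`. The extra input `λη` is a constant of finite norm
because the interval has finite measure, so it disappears as `η → 0`. -/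
theorem eLpNorm_sqrt_le {F F' g : ℝ → ℝ} {a b lam : ℝ} {p : ℝ≥0∞} (hab : a ≤ b)
    (hlam : 0 < lam) (hp : 1 ≤ p) (hF : ContinuousOn F (Icc a b))
    (hF' : ∀ t ∈ Ioo a b, HasDerivAt F (F' t) t) (h0 : ∀ t ∈ Icc a b, 0 ≤ F t)
    (hle : ∀ t ∈ Ioo a b, F' t ≤ -(2 * lam) * F t + 2 * Real.sqrt (F t) * g t)
    (hg : ∀ t, 0 ≤ g t) (hgm : AEStronglyMeasurable g (volume.restrict (Icc a b))) :
    eLpNorm (fun t => Real.sqrt (F t)) p (volume.restrict (Icc a b)) ≤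
      ENNReal.ofReal ((1 + 1 / lam) * Real.sqrt (F a))
      + ENNReal.ofReal (1 / lam) * eLpNorm g p (volume.restrict (Icc a b)) := by
  set μ := volume.restrict (Icc a b)
  set N := eLpNorm (fun _ : ℝ => (1 : ℝ)) p μ
  have hN : N ≠ ∞ := (memLp_const (μ := μ) (p := p) (1 : ℝ)).eLpNorm_ne_top
  have main : ∀ η : ℝ, 0 < η → eLpNorm (fun t => Real.sqrt (F t)) p μ ≤
      ENNReal.ofReal ((1 + 1 / lam) * (Real.sqrt (F a) + η)) +
      ENNReal.ofReal (1 / lam) * (eLpNorm g p μ + ENNReal.ofReal (lam * η) * N) := by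
    intro η hη
    have h1 := eLpNorm_le_of_linear (u := fun s => Real.sqrt (F s + η ^ 2))
      (g := fun t => g t + lam * η) (p := p) hab hlam hp
      (Real.continuous_sqrt.comp_continuousOn (hF.add continuousOn_const))
      (fun t ht => Real.sqrt_pos.2 (by have := h0 t ht; positivity))
      (fun t => by have := hg t; positivity)
      (hgm.add aestronglyMeasurable_const)
      (fun t ht => (hasDerivAt_sqrt_add_sq (hF' t ht) (h0 t (Ioo_subset_Icc_self ht)) (hg t)
        hη hlam.le (hle t ht)).1)
      (fun t ht => (hasDerivAt_sqrt_add_sq (hF' t ht) (h0 t (Ioo_subset_Icc_self ht)) (hg t)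
        hη hlam.le (hle t ht)).2)
    have h2 : eLpNorm (fun t => Real.sqrt (F t)) p μ ≤
        eLpNorm (fun s => Real.sqrt (F s + η ^ 2)) p μ := by
      apply eLpNorm_mono_real
      intro t
      rw [Real.norm_of_nonneg (Real.sqrt_nonneg _)]
      exact Real.sqrt_le_sqrt (by nlinarith)
    have h3 : eLpNorm (fun t => g t + lam * η) p μ ≤
        eLpNorm g p μ + ENNReal.ofReal (lam * η) * N := by
      refine (eLpNorm_add_le hgm aestronglyMeasurable_const hp).trans ?_
      gcongr
      have : (fun _ : ℝ => lam * η) = (lam * η) • (fun _ : ℝ => (1 : ℝ)) := by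
        ext; simp
      rw [this, eLpNorm_const_smul, Real.enorm_eq_ofReal (by positivity)]
    refine h2.trans (h1.trans ?_)
    gcongr
    exact sqrt_add_sq_le (h0 a (left_mem_Icc.2 hab)) hη.le
  have hlim : Tendsto (fun η : ℝ => ENNReal.ofReal ((1 + 1 / lam) * (Real.sqrt (F a) + η)) +
      ENNReal.ofReal (1 / lam) * (eLpNorm g p μ + ENNReal.ofReal (lam * η) * N))
      (nhdsWithin 0 (Ioi 0)) (nhds (ENNReal.ofReal ((1 + 1 / lam) * (Real.sqrt (F a) + 0)) +
      ENNReal.ofReal (1 / lam) * (eLpNorm g p μ + ENNReal.ofReal (lam * 0) * N))) := by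
    apply Tendsto.mono_left _ nhdsWithin_le_nhds
    apply Tendsto.add
    · exact ENNReal.tendsto_ofReal (Continuous.tendsto (by fun_prop) 0)
    · apply ENNReal.Tendsto.const_mul _ (Or.inr ENNReal.ofReal_ne_top)
      apply Tendsto.add tendsto_const_nhds
      apply ENNReal.Tendsto.mul_const _ (Or.inr hN)
      exact ENNReal.tendsto_ofReal (Continuous.tendsto (by fun_prop) 0)
  have := ge_of_tendsto hlim (by filter_upwards [self_mem_nhdsWithin] with η hη using main η hη)
  simpa using this

/-! ### Matrix-vector algebra, the kinematic matrix, and quadratic forms. -/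

theorem mv_add (A : M3) (v w : V3) : mv A (v + w) = mv A v + mv A w := map_add _ _ _

theorem mv_sub (A : M3) (v w : V3) : mv A (v - w) = mv A v - mv A w := map_sub _ _ _

theorem mv_neg (A : M3) (v : V3) : mv A (-v) = -mv A v := map_neg _ _

theorem sub_mv (A B : M3) (v : V3) : mv (A - B) v = mv A v - mv B v := by
  simp [mv, map_sub]

theorem smul_mv (c : ℝ) (A : M3) (v : V3) : mv (c • A) v = c • mv A v := by
  simp [mv, map_smul]

theorem one_mv (v : V3) : mv 1 v = v := by
  simp [mv]

theorem mul_mv (A B : M3) (v : V3) : mv (A * B) v = mv A (mv B v) := by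
  simp [mv, map_mul]

theorem norm_mv_le (A : M3) (v : V3) : ‖mv A v‖ ≤ sigmaMax A * ‖v‖ :=
  (Matrix.toEuclideanCLM (n := Fin 3) (𝕜 := ℝ) A).le_opNorm v

theorem sigmaMax_nonneg (A : M3) : 0 ≤ sigmaMax A := norm_nonneg _

theorem continuous_mv (A : M3) : Continuous (mv A) :=
  (Matrix.toEuclideanCLM (n := Fin 3) (𝕜 := ℝ) A).continuous

theorem HasDerivAt.mv {f : ℝ → V3} {f' : V3} {t : ℝ} (A : M3) (h : HasDerivAt f f' t) :
    HasDerivAt (fun s => mv A (f s)) (mv A f') t :=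
  (Matrix.toEuclideanCLM (n := Fin 3) (𝕜 := ℝ) A).hasFDerivAt.comp_hasDerivAt t h

theorem norm_sq_v3 (v : V3) : ‖v‖ ^ 2 = v 0 ^ 2 + v 1 ^ 2 + v 2 ^ 2 := by
  rw [EuclideanSpace.real_norm_sq_eq, Fin.sum_univ_three]

theorem inner_v3 (v w : V3) : inner ℝ v w = v 0 * w 0 + v 1 * w 1 + v 2 * w 2 := by
  simp [PiLp.inner_apply, Fin.sum_univ_three, mul_comm]

/-- `Z(q)` is `(1 + ‖q‖²)/4` times an orthogonal matrix. This gives the inverse explicitly, as a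
smooth function of `q`, and the exact decay of `‖Z⁻¹(q)v‖` for large `q`. -/
theorem mrpZ_mul_transpose (q : V3) :
    mrpZ q * (mrpZ q).transpose = (((1 + ‖q‖ ^ 2) / 4) ^ 2) • (1 : M3) := by
  ext i j
  rw [norm_sq_v3]
  fin_cases i <;> fin_cases j <;>
    simp [mrpZ, Matrix.mul_apply, Fin.sum_univ_three, norm_sq_v3, skew, Matrix.vecMulVec_apply] <;>
    ring

theorem norm_mv_mrpZ (q v : V3) : ‖mv (mrpZ q) v‖ = (1 + ‖q‖ ^ 2) / 4 * ‖v‖ := by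
  rw [← sq_eq_sq₀ (norm_nonneg _) (by positivity), mul_pow, norm_sq_v3 (mv _ _), norm_sq_v3 v]
  simp only [mv_apply, Fin.sum_univ_three]
  simp [mrpZ, norm_sq_v3, skew, Matrix.vecMulVec_apply]
  ring

theorem mrpZ_inv (q : V3) :
    (mrpZ q)⁻¹ = (((1 + ‖q‖ ^ 2) / 4) ^ 2)⁻¹ • (mrpZ q).transpose := by
  apply Matrix.inv_eq_right_inv
  rw [Matrix.mul_smul, mrpZ_mul_transpose, smul_smul, inv_mul_cancel₀ (by positivity), one_smul]

theorem mrpZ_mul_inv (q : V3) : mrpZ q * (mrpZ q)⁻¹ = 1 := by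
  rw [mrpZ_inv, Matrix.mul_smul, mrpZ_mul_transpose, smul_smul, inv_mul_cancel₀ (by positivity),
    one_smul]

theorem mv_mrpZ_mv_inv (q v : V3) : mv (mrpZ q) (mv (mrpZ q)⁻¹ v) = v := by
  rw [← mul_mv, mrpZ_mul_inv, one_mv]

theorem norm_mv_mrpZ_inv (q v : V3) : ‖mv (mrpZ q)⁻¹ v‖ = 4 / (1 + ‖q‖ ^ 2) * ‖v‖ := by
  have h := norm_mv_mrpZ q (mv (mrpZ q)⁻¹ v)
  rw [mv_mrpZ_mv_inv] at h
  rw [h]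
  field_simp

theorem sigmaMax_mrpZ_le (q : V3) : sigmaMax (mrpZ q) ≤ (1 + ‖q‖ ^ 2) / 4 :=
  ContinuousLinearMap.opNorm_le_bound _ (by positivity) fun v => (norm_mv_mrpZ q v).le

theorem differentiableAt_mv_mrpZ_inv {q v : ℝ → V3} {t : ℝ} (hq : DifferentiableAt ℝ q t)
    (hv : DifferentiableAt ℝ v t) :
    DifferentiableAt ℝ (fun s => mv (mrpZ (q s))⁻¹ (v s)) t := by
  have hqi : ∀ i, DifferentiableAt ℝ (fun s => q s i) t := differentiableAt_euclidean.1 hq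
  have hvi : ∀ i, DifferentiableAt ℝ (fun s => v s i) t := differentiableAt_euclidean.1 hv
  have hn : ∀ s, (((1 + ‖q s‖ ^ 2) / 4) ^ 2) ≠ 0 := fun s => by positivity
  have hd : DifferentiableAt ℝ (fun s => ((((1 + ‖q s‖ ^ 2) / 4) ^ 2)⁻¹ : ℝ)) t := by
    have h1 : DifferentiableAt ℝ (fun s => ((1 + ‖q s‖ ^ 2) / 4) ^ 2) t :=
      (((hq.norm_sq ℝ).const_add 1).div_const 4).pow 2
    exact h1.fun_inv (hn t)
  simp only [mrpZ_inv, smul_mv]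
  apply hd.fun_smul
  rw [differentiableAt_euclidean]
  have h0 := hqi 0
  have h1 := hqi 1
  have h2 := hqi 2
  have k0 := hvi 0
  have k1 := hvi 1
  have k2 := hvi 2
  intro i
  fin_cases i <;>
    simp [mv_apply, Fin.sum_univ_three, mrpZ, norm_sq_v3, skew, Matrix.vecMulVec_apply] <;>
    fun_prop

/-- Minimum of the form over the compact unit sphere, extended by homogeneity; symmetry plays no
role. -/
theorem PosDefForm.exists_coercive {A : M3} (hA : PosDefForm A) :
    ∃ m : ℝ, 0 < m ∧ ∀ x : V3, m * ‖x‖ ^ 2 ≤ inner ℝ x (mv A x) := by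
  have hc : ContinuousOn (fun x : V3 => (inner ℝ x (mv A x) : ℝ)) (Metric.sphere 0 1) :=
    (continuous_id.inner (continuous_mv A)).continuousOn
  obtain ⟨x0, hx0, hmin⟩ := (isCompact_sphere (0 : V3) 1).exists_isMinOn
    (NormedSpace.sphere_nonempty.2 zero_le_one) hc
  have hx0' : x0 ≠ 0 := by
    rintro rfl
    simp at hx0
  refine ⟨_, hA x0 hx0', fun x => ?_⟩
  rcases eq_or_ne x 0 with rfl | hx
  · simp
  have hn : 0 < ‖x‖ := norm_pos_iff.2 hx
  have h := hmin (a := ‖x‖⁻¹ • x) (by simp [norm_smul, hn.ne'])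
  simp only [mem_ofPred_eq] at h
  have e : mv A (‖x‖⁻¹ • x) = ‖x‖⁻¹ • mv A x := map_smul _ _ _
  rw [e, inner_smul_left, inner_smul_right] at h
  simp only [conj_trivial] at h
  rw [← mul_assoc, ← sq, inv_pow, ← div_eq_inv_mul, le_div_iff₀ (by positivity)] at h
  exact h

theorem inner_mv_comm {J : M3} (hJ : J.IsHermitian) (v w : V3) :
    (inner ℝ v (mv J w) : ℝ) = inner ℝ w (mv J v) := by
  have h : ∀ i j, J i j = J j i := fun i j => by simpa using (hJ.apply i j).symm
  simp only [inner_v3, mv_apply, Fin.sum_univ_three, h 1 0, h 2 0, h 2 1]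
  ring

theorem posDefForm_of_posDef {J : M3} (hJ : J.PosDef) : PosDefForm J := by
  intro x hx
  have h := hJ.dotProduct_mulVec_pos (x := x.ofLp) (by simpa using hx)
  rw [inner_v3]
  simpa [dotProduct, Matrix.mulVec, Fin.sum_univ_three, mv_apply] using h

theorem inner_mv_skew_self (a e : V3) : (inner ℝ e (mv (skew a) e) : ℝ) = 0 := by
  simp [inner_v3, mv_apply, Fin.sum_univ_three, skew]
  ring

/-- Lagrange's identity: the difference of the squares is `⟨a, e⟩²`. -/
theorem norm_mv_skew_le (a e : V3) : ‖mv (skew a) e‖ ≤ ‖a‖ * ‖e‖ := by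
  rw [← sq_le_sq₀ (norm_nonneg _) (by positivity), mul_pow, norm_sq_v3 a, norm_sq_v3 e,
    norm_sq_v3 (mv _ _)]
  simp [mv_apply, Fin.sum_univ_three, skew]
  nlinarith [sq_nonneg (a 0 * e 0 + a 1 * e 1 + a 2 * e 2)]

theorem mv_skew_sub_left (a b e : V3) : mv (skew (a - b)) e = mv (skew a) e - mv (skew b) e := by
  ext i
  fin_cases i <;> simp [mv_apply, Fin.sum_univ_three, skew] <;> ring

/-! ### The abstract error system, its energy and its cross term. -/

/-- Quantitative bounds on the inertia matrix and on the proportional and integral gains. -/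
structure GainBounds (J Km : M3) (KI : ℝ → M3) (jm jM km kM c : ℝ) : Prop where
  jm_pos : 0 < jm
  jM_pos : 0 < jM
  km_pos : 0 < km
  kM_pos : 0 < kM
  c_pos : 0 < c
  symm : J.IsHermitian
  J_lower : ∀ x : V3, jm * ‖x‖ ^ 2 ≤ inner ℝ x (mv J x)
  J_upper : ∀ x : V3, ‖mv J x‖ ≤ jM * ‖x‖
  Km_lower : ∀ x : V3, km * ‖x‖ ^ 2 ≤ inner ℝ x (mv Km x)
  Km_upper : ∀ x : V3, ‖mv Km x‖ ≤ kM * ‖x‖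
  KI_diag : ∀ t, 0 ≤ t → (KI t).IsDiag
  KI_pos : ∀ t, 0 ≤ t → ∀ i, 0 < KI t i i
  KI_inv : ∀ t, 0 ≤ t → ∀ i, 1 / KI t i i ≤ c ^ 2
  KI_diff : ∀ t, 0 ≤ t → ∀ i, DifferentiableAt ℝ (fun s => KI s i i) t
  KI_mono : ∀ t, 0 ≤ t → ∀ i, 0 ≤ deriv (fun s => KI s i i) t

/-- The error dynamics `J ė = S(J ω̂) e - K_m e - z + d`, `ż = K_I e - δ` for positive times. -/
structure ErrorSystem (J Km : M3) (KI : ℝ → M3) (wh e z d δ : ℝ → V3) : Prop where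
  cont_e : ContinuousOn e (Ici 0)
  cont_z : ContinuousOn z (Ici 0)
  deriv_e : ∀ t, 0 < t → ∃ e' : V3, HasDerivAt e e' t ∧
    mv J e' = mv (skew (mv J (wh t))) (e t) - mv Km (e t) - z t + d t
  deriv_z : ∀ t, 0 < t → HasDerivAt z (mv (KI t) (e t) - δ t) t

/-- The squared norm of the integral state, weighted with the inverse integral gain. -/
noncomputable def weightedSq (KI : ℝ → M3) (z : ℝ → V3) (t : ℝ) : ℝ := ∑ i, z t i ^ 2 / KI t i i

/-- The energy `½ eᵀ J e + ½ zᵀ K_I⁻¹ z`. -/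
noncomputable def energy (J : M3) (KI : ℝ → M3) (e z : ℝ → V3) (t : ℝ) : ℝ :=
  (1 / 2) * inner ℝ (e t) (mv J (e t)) + (1 / 2) * weightedSq KI z t

/-- The cross term `zᵀ K_I⁻¹ J e`. -/
noncomputable def crossEnergy (J : M3) (KI : ℝ → M3) (e z : ℝ → V3) (t : ℝ) : ℝ :=
  ∑ i, z t i * mv J (e t) i / KI t i i

/-- The trace of the inverse integral gain. -/
noncomputable def gainInv (KI : ℝ → M3) (t : ℝ) : ℝ := ∑ i, 1 / KI t i i

/-- Cauchy-Schwarz in the inner product weighted by `K_I⁻¹`. Only the second factor is converted to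
the Euclidean norm; converting the first one would need an upper bound on `K_I`. -/
theorem sum_mul_div_le {k : Fin 3 → ℝ} (hk : ∀ i, 0 < k i) {c : ℝ} (hc : 0 ≤ c)
    (hkc : ∀ i, 1 / k i ≤ c ^ 2) (z w : V3) :
    |∑ i, z i * w i / k i| ≤ c * Real.sqrt (∑ i, z i ^ 2 / k i) * ‖w‖ := by
  have h0 : 0 ≤ ∑ i, z i ^ 2 / k i := Finset.sum_nonneg fun i _ => by
    have := hk i; positivity
  apply abs_le_of_sq_le_sq _ (by positivity)
  rw [mul_pow, mul_pow, Real.sq_sqrt h0]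
  have h1 := Finset.sum_mul_sq_le_sq_mul_sq Finset.univ (fun i => z i / Real.sqrt (k i))
    (fun i => w i / Real.sqrt (k i))
  have e1 : ∀ i, z i / Real.sqrt (k i) * (w i / Real.sqrt (k i)) = z i * w i / k i := fun i => by
    rw [div_mul_div_comm, Real.mul_self_sqrt (hk i).le]
  have e2 : ∀ (v : V3) i, (v i / Real.sqrt (k i)) ^ 2 = v i ^ 2 / k i := fun v i => by
    rw [div_pow, Real.sq_sqrt (hk i).le]
  simp only [e1, e2] at h1
  have h2 : ∑ i, w i ^ 2 / k i ≤ c ^ 2 * ‖w‖ ^ 2 := by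
    rw [EuclideanSpace.real_norm_sq_eq, Finset.mul_sum]
    refine Finset.sum_le_sum fun i _ => ?_
    have := mul_le_mul_of_nonneg_right (hkc i) (sq_nonneg (w i))
    rwa [one_div_mul_eq_div] at this
  calc _ ≤ _ := h1
    _ ≤ (∑ i, z i ^ 2 / k i) * (c ^ 2 * ‖w‖ ^ 2) := mul_le_mul_of_nonneg_left h2 h0
    _ = _ := by ring

theorem weighted_sqrt_le {k : Fin 3 → ℝ} {c : ℝ} (hc : 0 ≤ c)
    (hkc : ∀ i, 1 / k i ≤ c ^ 2) (w : V3) : Real.sqrt (∑ i, w i ^ 2 / k i) ≤ c * ‖w‖ := by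
  apply Real.sqrt_le_iff.2 ⟨by positivity, ?_⟩
  rw [mul_pow, EuclideanSpace.real_norm_sq_eq, Finset.mul_sum]
  refine Finset.sum_le_sum fun i _ => ?_
  have := mul_le_mul_of_nonneg_right (hkc i) (sq_nonneg (w i))
  rwa [one_div_mul_eq_div] at this

namespace GainBounds

variable {J Km : M3} {KI : ℝ → M3} {jm jM km kM c : ℝ}

theorem weightedSq_nonneg (G : GainBounds J Km KI jm jM km kM c) (z : ℝ → V3) {t : ℝ}
    (ht : 0 ≤ t) : 0 ≤ weightedSq KI z t :=
  Finset.sum_nonneg fun i _ => div_nonneg (sq_nonneg _) (G.KI_pos t ht i).le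

theorem weightedSq_le (G : GainBounds J Km KI jm jM km kM c) (z : ℝ → V3) {t : ℝ}
    (ht : 0 ≤ t) : weightedSq KI z t ≤ c ^ 2 * ‖z t‖ ^ 2 := by
  have h := weighted_sqrt_le G.c_pos.le (G.KI_inv t ht) (z t)
  rw [← mul_pow]
  exact (Real.sqrt_le_left (by have := G.c_pos; positivity)).1 h

theorem energy_lower (G : GainBounds J Km KI jm jM km kM c) (e z : ℝ → V3) (t : ℝ) :
    jm / 2 * ‖e t‖ ^ 2 + 1 / 2 * weightedSq KI z t ≤ energy J KI e z t := by
  have := G.J_lower (e t)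
  unfold energy
  linarith

theorem energy_upper (G : GainBounds J Km KI jm jM km kM c) (e z : ℝ → V3) (t : ℝ) :
    energy J KI e z t ≤ jM / 2 * ‖e t‖ ^ 2 + 1 / 2 * weightedSq KI z t := by
  have h1 := real_inner_le_norm (e t) (mv J (e t))
  have h2 := mul_le_mul_of_nonneg_left (G.J_upper (e t)) (norm_nonneg (e t))
  unfold energy
  nlinarith

theorem abs_crossEnergy_le (G : GainBounds J Km KI jm jM km kM c) (e z : ℝ → V3) {t : ℝ}
    (ht : 0 ≤ t) :
    |crossEnergy J KI e z t| ≤ c * Real.sqrt (weightedSq KI z t) * (jM * ‖e t‖) :=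
  (sum_mul_div_le (G.KI_pos t ht) G.c_pos.le (G.KI_inv t ht) (z t) (mv J (e t))).trans
    (mul_le_mul_of_nonneg_left (G.J_upper _) (mul_nonneg G.c_pos.le (Real.sqrt_nonneg _)))

theorem gainInv_nonneg (G : GainBounds J Km KI jm jM km kM c) {t : ℝ} (ht : 0 ≤ t) :
    0 ≤ gainInv KI t :=
  Finset.sum_nonneg fun i _ => by have := G.KI_pos t ht i; positivity

theorem gainInv_le (G : GainBounds J Km KI jm jM km kM c) {t : ℝ} (ht : 0 ≤ t) :
    gainInv KI t ≤ 3 * c ^ 2 := by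
  have := Finset.sum_le_sum fun i (_ : i ∈ Finset.univ) => G.KI_inv t ht i
  simpa [gainInv] using this

theorem mv_KI (G : GainBounds J Km KI jm jM km kM c) {t : ℝ} (ht : 0 ≤ t) (v : V3) (i : Fin 3) :
    mv (KI t) v i = KI t i i * v i := by
  rw [mv_apply]
  exact Finset.sum_eq_single i (fun j _ hj => by rw [G.KI_diag t ht hj.symm, zero_mul]) (by simp)

theorem continuousOn_KI (G : GainBounds J Km KI jm jM km kM c) (i : Fin 3) :
    ContinuousOn (fun t => KI t i i) (Ici 0) :=
  fun t ht => (G.KI_diff t ht i).continuousAt.continuousWithinAt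

end GainBounds

namespace ErrorSystem

variable {J Km : M3} {KI : ℝ → M3} {jm jM km kM c : ℝ} {wh e z d δ : ℝ → V3}

theorem continuousOn_energy (S : ErrorSystem J Km KI wh e z d δ)
    (G : GainBounds J Km KI jm jM km kM c) : ContinuousOn (energy J KI e z) (Ici 0) := by
  unfold energy weightedSq
  refine (continuousOn_const.mul (S.cont_e.inner ((continuous_mv J).comp_continuousOn S.cont_e))).add
    (continuousOn_const.mul (continuousOn_finsetSum _ fun i _ => ?_))
  exact (((continuous_apply i).comp (PiLp.continuous_ofLp 2 _)).comp_continuousOn S.cont_z |>.pow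
    2).div (G.continuousOn_KI i) fun t ht => (G.KI_pos t ht i).ne'

theorem continuousOn_crossEnergy (S : ErrorSystem J Km KI wh e z d δ)
    (G : GainBounds J Km KI jm jM km kM c) : ContinuousOn (crossEnergy J KI e z) (Ici 0) := by
  unfold crossEnergy
  refine continuousOn_finsetSum _ fun i _ => ?_
  have hi : Continuous fun v : V3 => v i := (continuous_apply i).comp (PiLp.continuous_ofLp 2 _)
  exact ((hi.comp_continuousOn S.cont_z).mul
    (hi.comp_continuousOn ((continuous_mv J).comp_continuousOn S.cont_e))).div
    (G.continuousOn_KI i) fun t ht => (G.KI_pos t ht i).ne'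

theorem _root_.GainBounds.continuousOn_gainInv
    (G : GainBounds J Km KI jm jM km kM c) : ContinuousOn (gainInv KI) (Ici 0) := by
  unfold gainInv
  exact continuousOn_finsetSum _ fun i _ => continuousOn_const.div (G.continuousOn_KI i)
    fun t ht => (G.KI_pos t ht i).ne'

/-- Here `β = Σ k'ᵢ/kᵢ²` and `Q = Σ zᵢ² k'ᵢ/kᵢ²` carry the whole effect of the varying gain. Both
are nonnegative by monotonicity but have no a priori upper bound, so they are kept explicit: the
terms in `Q` are later cancelled between `V'` and `X'`, those in `β` by the derivative of the weight
`gainInv`. -/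
theorem exists_derivs (S : ErrorSystem J Km KI wh e z d δ)
    (G : GainBounds J Km KI jm jM km kM c) {t : ℝ} (ht : 0 < t) :
    ∃ V' X' β Q : ℝ, HasDerivAt (energy J KI e z) V' t ∧ HasDerivAt (crossEnergy J KI e z) X' t ∧
      HasDerivAt (gainInv KI) (-β) t ∧ 0 ≤ β ∧ 0 ≤ Q ∧
      V' ≤ -km * ‖e t‖ ^ 2 + ‖e t‖ * ‖d t‖
        + c * Real.sqrt (weightedSq KI z t) * ‖δ t‖ - Q / 2 ∧
      X' ≤ jM * ‖e t‖ ^ 2 + c ^ 2 * ‖δ t‖ * (jM * ‖e t‖)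
        + c * Real.sqrt (weightedSq KI z t) *
          (jM * ‖wh t‖ * ‖e t‖ + kM * ‖e t‖ + ‖d t‖)
        - weightedSq KI z t + Q / 2 + β * (jM * ‖e t‖) ^ 2 / 2 := by
  obtain ⟨e', he, hJe⟩ := S.deriv_e t ht
  have hz := S.deriv_z t ht
  have hco : ∀ {f : ℝ → V3} {f' : V3} (i : Fin 3), HasDerivAt f f' t →
      HasDerivAt (fun s => f s i) (f' i) t := fun i h =>
    (EuclideanSpace.proj (𝕜 := ℝ) i).hasFDerivAt.comp_hasDerivAt t h
  set k : Fin 3 → ℝ := fun i => KI t i i with hk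
  set k' : Fin 3 → ℝ := fun i => deriv (fun s => KI s i i) t with hk'
  have hkd : ∀ i, HasDerivAt (fun s => KI s i i) (k' i) t :=
    fun i => (G.KI_diff t ht.le i).hasDerivAt
  have hkp : ∀ i, 0 < k i := G.KI_pos t ht.le
  have hkp' : ∀ i, 0 ≤ k' i := G.KI_mono t ht.le
  have hki : ∀ i, 1 / k i ≤ c ^ 2 := G.KI_inv t ht.le
  have hzi : ∀ i, HasDerivAt (fun s => z s i) (k i * e t i - δ t i) t := fun i => by
    have := hco i hz
    simpa [G.mv_KI ht.le] using this
  set w := mv J (e t) with hw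
  set w' := mv J e' with hw'
  have hwi : ∀ i, HasDerivAt (fun s => mv J (e s) i) (w' i) t := fun i => hco i (he.mv J)
  have dP : HasDerivAt (weightedSq KI z)
      (∑ i, (2 * z t i * (k i * e t i - δ t i) * k i - z t i ^ 2 * k' i) / k i ^ 2) t := by
    unfold weightedSq
    apply HasDerivAt.fun_sum
    intro i _
    exact (((hzi i).fun_pow 2).fun_div (hkd i) (hkp i).ne').congr_deriv (by simp [hk])
  have dX : HasDerivAt (crossEnergy J KI e z)
      (∑ i, (((k i * e t i - δ t i) * w i + z t i * w' i) * k i - z t i * w i * k' i)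
        / k i ^ 2) t := by
    unfold crossEnergy
    apply HasDerivAt.fun_sum
    intro i _
    exact ((hzi i).fun_mul (hwi i)).fun_div (hkd i) (hkp i).ne'
  have dk : HasDerivAt (gainInv KI) (-∑ i, k' i / k i ^ 2) t := by
    unfold gainInv
    rw [← Finset.sum_neg_distrib]
    apply HasDerivAt.fun_sum
    intro i _
    exact ((hasDerivAt_const t (1 : ℝ)).fun_div (hkd i) (hkp i).ne').congr_deriv
      (by simp only [hk]; ring)
  have dE : HasDerivAt (fun s => (inner ℝ (e s) (mv J (e s)) : ℝ)) (2 * inner ℝ (e t) w') t := by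
    refine (he.inner ℝ (he.mv J)).congr_deriv ?_
    rw [inner_mv_comm G.symm e' (e t)]
    ring
  have hin : ∀ v u : V3, (inner ℝ v u : ℝ) = ∑ i, v i * u i := fun v u => by
    rw [inner_v3, Fin.sum_univ_three]
  -- The gyroscopic term does no work by skew symmetry; the remaining coupling `-⟨e, z⟩` will cancel
  -- against the integral part of the energy.
  have hw'e : (inner ℝ (e t) w' : ℝ) =
      -inner ℝ (e t) (mv Km (e t)) - ∑ i, e t i * z t i + inner ℝ (e t) (d t) := by
    rw [hJe, inner_add_right, inner_sub_right, inner_sub_right, inner_mv_skew_self, hin _ (z t)]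
    ring
  refine ⟨_, _, _, ∑ i, z t i ^ 2 * k' i / k i ^ 2,
    (dE.const_mul (1 / 2)).add (dP.const_mul (1 / 2)), dX, dk, ?_, ?_, ?_, ?_⟩
  · exact Finset.sum_nonneg fun i _ => div_nonneg (hkp' i) (sq_nonneg _)
  · exact Finset.sum_nonneg fun i _ => div_nonneg (mul_nonneg (sq_nonneg _) (hkp' i)) (sq_nonneg _)
  · have h1 : (∑ i, (2 * z t i * (k i * e t i - δ t i) * k i - z t i ^ 2 * k' i) / k i ^ 2) =
        2 * (∑ i, e t i * z t i) - 2 * (∑ i, z t i * δ t i / k i)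
          - ∑ i, z t i ^ 2 * k' i / k i ^ 2 := by
      rw [Finset.mul_sum, Finset.mul_sum, ← Finset.sum_sub_distrib, ← Finset.sum_sub_distrib]
      refine Finset.sum_congr rfl fun i _ => ?_
      have := (hkp i).ne'
      field_simp
    rw [h1, hw'e]
    have h2 := G.Km_lower (e t)
    have h3 := real_inner_le_norm (e t) (d t)
    have h4 := neg_le_of_abs_le (sum_mul_div_le hkp G.c_pos.le hki (z t) (δ t))
    change -(c * Real.sqrt (weightedSq KI z t) * ‖δ t‖) ≤ _ at h4
    linarith
  · have h1 : (∑ i, (((k i * e t i - δ t i) * w i + z t i * w' i) * k i - z t i * w i * k' i)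
        / k i ^ 2) = (∑ i, e t i * w i) - (∑ i, δ t i * w i / k i) + (∑ i, z t i * w' i / k i)
          - ∑ i, z t i * w i * k' i / k i ^ 2 := by
      rw [← Finset.sum_sub_distrib, ← Finset.sum_add_distrib, ← Finset.sum_sub_distrib]
      refine Finset.sum_congr rfl fun i _ => ?_
      have := (hkp i).ne'
      field_simp
    have hwn : ‖w‖ ≤ jM * ‖e t‖ := G.J_upper _
    have h2 : ∑ i, e t i * w i ≤ jM * ‖e t‖ ^ 2 := by
      rw [← hin]
      have := real_inner_le_norm (e t) w
      have := mul_le_mul_of_nonneg_left hwn (norm_nonneg (e t))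
      nlinarith
    have h3 : -∑ i, δ t i * w i / k i ≤ c ^ 2 * ‖δ t‖ * (jM * ‖e t‖) := by
      have h4 := neg_le_of_abs_le (sum_mul_div_le hkp G.c_pos.le hki (δ t) w)
      have h5 := weighted_sqrt_le G.c_pos.le hki (δ t)
      have h6 : c * Real.sqrt (∑ i, δ t i ^ 2 / k i) * ‖w‖ ≤
          c * (c * ‖δ t‖) * (jM * ‖e t‖) := by
        have := G.c_pos
        gcongr
      linarith
    have h4 : ∑ i, z t i * w' i / k i ≤ c * Real.sqrt (weightedSq KI z t) *
        (jM * ‖wh t‖ * ‖e t‖ + kM * ‖e t‖ + ‖d t‖) - weightedSq KI z t := by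
      -- Isolating `-z` in `J ė` produces the damping `-weightedSq` of the integral state.
      set v := mv (skew (mv J (wh t))) (e t) - mv Km (e t) + d t with hv
      have h5 : w' = v - z t := by rw [hJe, hv]; abel
      have h6 : ∑ i, z t i * w' i / k i = (∑ i, z t i * v i / k i) - weightedSq KI z t := by
        rw [h5, weightedSq, ← Finset.sum_sub_distrib]
        refine Finset.sum_congr rfl fun i _ => ?_
        simp only [PiLp.sub_apply]
        ring
      have h7 := le_of_abs_le (sum_mul_div_le hkp G.c_pos.le hki (z t) v)
      have h8 : ‖v‖ ≤ jM * ‖wh t‖ * ‖e t‖ + kM * ‖e t‖ + ‖d t‖ := by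
        have := norm_add_le (mv (skew (mv J (wh t))) (e t) - mv Km (e t)) (d t)
        have := norm_sub_le (mv (skew (mv J (wh t))) (e t)) (mv Km (e t))
        have := G.Km_upper (e t)
        have := norm_mv_skew_le (mv J (wh t)) (e t)
        have := mul_le_mul_of_nonneg_right (G.J_upper (wh t)) (norm_nonneg (e t))
        linarith
      have h9 := mul_le_mul_of_nonneg_left h8
        (mul_nonneg G.c_pos.le (Real.sqrt_nonneg (weightedSq KI z t)))
      change _ ≤ c * Real.sqrt (weightedSq KI z t) * ‖v‖ at h7
      linarith
    -- Young's inequality with weight `k'ᵢ/kᵢ² ≥ 0` on each coordinate: the `z` part becomes `Q/2`,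
    -- the `J e` part is charged to `β`.
    have h5 : -∑ i, z t i * w i * k' i / k i ^ 2 ≤ (∑ i, z t i ^ 2 * k' i / k i ^ 2) / 2 +
        (∑ i, k' i / k i ^ 2) * (jM * ‖e t‖) ^ 2 / 2 := by
      have h6 : ‖w‖ ^ 2 ≤ (jM * ‖e t‖) ^ 2 := by gcongr
      have h7 : ∀ i, -(z t i * w i * k' i / k i ^ 2) ≤ z t i ^ 2 * k' i / k i ^ 2 / 2 +
          k' i / k i ^ 2 * (jM * ‖e t‖) ^ 2 / 2 := by
        intro i
        have h8 : 0 ≤ k' i / k i ^ 2 := div_nonneg (hkp' i) (sq_nonneg _)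
        have h9 : w i ^ 2 ≤ (jM * ‖e t‖) ^ 2 := by
          refine le_trans ?_ h6
          rw [EuclideanSpace.real_norm_sq_eq]
          exact Finset.single_le_sum (f := fun j => w j ^ 2) (fun j _ => sq_nonneg _)
            (Finset.mem_univ i)
        have e1 : z t i * w i * k' i / k i ^ 2 = k' i / k i ^ 2 * (z t i * w i) := by ring
        have e2 : z t i ^ 2 * k' i / k i ^ 2 = k' i / k i ^ 2 * z t i ^ 2 := by ring
        rw [e1, e2]
        nlinarith [mul_nonneg h8 (sq_nonneg (z t i + w i)), mul_le_mul_of_nonneg_left h9 h8]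
      rw [← Finset.sum_neg_distrib, Finset.sum_mul, Finset.sum_div, Finset.sum_div,
        ← Finset.sum_add_distrib]
      exact Finset.sum_le_sum fun i _ => h7 i
    rw [h1]
    linarith

end ErrorSystem

/-! ### Lyapunov inequalities as real-variable statements. -/

/-- Chooses one small coefficient for the cross term that meets finitely many smallness conditions.
-/
theorem exists_pos_mul_le (l : List (ℝ × ℝ)) (hl : ∀ x ∈ l, 0 ≤ x.1 ∧ 0 < x.2) :
    ∃ ε : ℝ, 0 < ε ∧ ∀ x ∈ l, ε * x.1 ≤ x.2 := by
  induction l with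
  | nil => exact ⟨1, one_pos, by simp⟩
  | cons y l ih =>
    obtain ⟨ε, hε, h⟩ := ih fun x hx => hl x (List.mem_cons_of_mem _ hx)
    obtain ⟨h1, h2⟩ := hl y List.mem_cons_self
    refine ⟨min ε (y.2 / (y.1 + 1)), by positivity, fun x hx => ?_⟩
    rcases List.mem_cons.1 hx with rfl | hx
    · calc min ε (x.2 / (x.1 + 1)) * x.1 ≤ x.2 / (x.1 + 1) * (x.1 + 1) := by
            gcongr
            · exact min_le_right _ _
            · linarith
        _ = x.2 := by field_simp
    · exact (mul_le_mul_of_nonneg_right (min_le_left _ _)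
        (hl x (List.mem_cons_of_mem _ hx)).1).trans (h x hx)

/-- Bounds on the energy `V` and the cross term `X` in terms of `x = ‖e‖` and the weighted norm
`s` of the integral state. -/
structure EnergyBounds (jm jM c x s V X k : ℝ) : Prop where
  x0 : 0 ≤ x
  s0 : 0 ≤ s
  k0 : 0 ≤ k
  k1 : k ≤ 3 * c ^ 2
  V0 : jm / 2 * x ^ 2 + 1 / 2 * s ^ 2 ≤ V
  V1 : V ≤ jM / 2 * x ^ 2 + 1 / 2 * s ^ 2
  X1 : |X| ≤ c * s * (jM * x)

/-- Bounds on the derivatives of the energy and of the cross term. -/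
structure EnergyIneq (jm jM km kM c x s w dn D V X k V' X' β Q : ℝ) : Prop
    extends EnergyBounds jm jM c x s V X k where
  β0 : 0 ≤ β
  Q0 : 0 ≤ Q
  dV : V' ≤ -km * x ^ 2 + x * dn + c * s * D - Q / 2
  dX : X' ≤ jM * x ^ 2 + c ^ 2 * D * (jM * x) + c * s * (jM * w * x + kM * x + dn)
    - s ^ 2 + Q / 2 + β * (jM * x) ^ 2 / 2

/-- Makes the cross term a perturbation of the energy, so that adding it preserves equivalence with
`V`. -/
theorem EnergyBounds.abs_cross_le {jm jM c x s V X k ε : ℝ} (h : EnergyBounds jm jM c x s V X k)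
    (hc : 0 ≤ c * jM) (hε : 0 < ε) (h1 : ε * (c * jM) ≤ 1 / 2) (h2 : ε * (c * jM) ≤ jm / 2) :
    |ε * X| ≤ V / 2 := by
  rw [abs_mul, abs_of_pos hε]
  have h3 := mul_le_mul_of_nonneg_left h.X1 hε.le
  have h5 : ε * (c * jM) * (s * x) ≤ ε * (c * jM) * ((s ^ 2 + x ^ 2) / 2) :=
    mul_le_mul_of_nonneg_left (by nlinarith [sq_nonneg (s - x)]) (by positivity)
  have h6 := mul_le_mul_of_nonneg_right h1 (sq_nonneg s)
  have h7 := mul_le_mul_of_nonneg_right h2 (sq_nonneg x)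
  have := h.V0
  linarith

theorem EnergyBounds.energy_le {jm jM c x s V X k : ℝ} (h : EnergyBounds jm jM c x s V X k)
    (hjM : 0 ≤ jM) : V ≤ (jM + 1) / 2 * (x ^ 2 + s ^ 2) := by
  have := h.V1
  have := mul_nonneg hjM (sq_nonneg s)
  have := sq_nonneg x
  linarith

theorem EnergyBounds.sq_int_le {jm jM c x s V X k : ℝ} (h : EnergyBounds jm jM c x s V X k)
    (hjm : 0 ≤ jm) : s ^ 2 ≤ 2 * V := by
  have := h.V0
  have := mul_nonneg hjm (sq_nonneg x)
  linarith

theorem EnergyBounds.sq_err_le {jm jM c x s V X k : ℝ} (h : EnergyBounds jm jM c x s V X k) :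
    jm * x ^ 2 ≤ 2 * V := by
  have := h.V0
  have := sq_nonneg s
  linarith

theorem mul_le_half_sq_add (x y : ℝ) : x * y ≤ x ^ 2 / 2 + y ^ 2 / 2 := by
  linarith [sq_nonneg (x - y)]

theorem mul_le_quarter_sq_add (x y : ℝ) : x * y ≤ x ^ 2 / 4 + y ^ 2 := by
  linarith [sq_nonneg (x / 2 - y)]

set_option maxHeartbeats 1000000 in
/-- A Lyapunov function for the error system with bounded angular velocity. -/
theorem exists_lyapunov {jm jM km kM c W : ℝ} (hjm : 0 < jm) (hjM : 0 < jM) (hkm : 0 < km)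
    (hkM : 0 < kM) (hc : 0 < c) (hW : 0 ≤ W) :
    ∃ a ε lam γ K : ℝ, 0 ≤ a ∧ 0 < ε ∧ 0 < lam ∧ 0 < γ ∧ 0 < K ∧
      (∀ x s V X k : ℝ, EnergyBounds jm jM c x s V X k →
        V / 2 ≤ (1 + a * k) * V + ε * X ∧ (1 + a * k) * V + ε * X ≤ K * V) ∧
      ∀ x s w D V X k V' X' β Q : ℝ, EnergyIneq jm jM km kM c x s w 0 D V X k V' X' β Q →
        w ≤ W → 0 ≤ D →
        (1 + a * k) * V' - a * β * V + ε * X' ≤ -(2 * lam) * ((1 + a * k) * V + ε * X)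
          + 2 * Real.sqrt ((1 + a * k) * V + ε * X) * (γ * D) := by
  set M := c * (jM * W + kM) with hM
  have hM0 : 0 < M := by positivity
  -- The second and third conditions let `-km x²` absorb the `x²` and `s x` terms of `ε X'`; the
  -- last two are those of `abs_cross_le`.
  obtain ⟨ε, hε, hl⟩ := exists_pos_mul_le
    [(1, 1), (jM, km / 4), (M ^ 2, km / 2), (c * jM, 1 / 2), (c * jM, jm / 2)] (by
      simp only [List.mem_cons, List.not_mem_nil, or_false]
      rintro x (rfl | rfl | rfl | rfl | rfl) <;> constructor <;> dsimp only <;> positivity)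
  simp only [List.mem_cons, List.not_mem_nil, or_false, forall_eq_or_imp, forall_eq] at hl
  obtain ⟨e1, e2, e3, e4, e5⟩ := hl
  -- With this value `a β V ≥ a β jm x²/2 = β (jM x)²/2`, exactly the term left in `X'` by the
  -- varying gain.
  set a := jM ^ 2 / jm with ha
  set A := 1 + 3 * a * c ^ 2 with hA
  have ha0 : 0 < a := by positivity
  have hA0 : 1 ≤ A := by rw [hA]; have : 0 ≤ 3 * a * c ^ 2 := by positivity
                         linarith
  set K1 := (A + 1 / 2) * (jM + 1) / 2 with hK1
  have hK10 : 0 < K1 := by positivity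
  set μ := min (km / 2) (ε / 2) with hμ
  have hμ0 : 0 < μ := by positivity
  have hL : ∀ x s V X k : ℝ, EnergyBounds jm jM c x s V X k →
      V / 2 ≤ (1 + a * k) * V + ε * X ∧ (1 + a * k) * V + ε * X ≤ (A + 1 / 2) * V := by
    intro x s V X k h
    have h1 := abs_le.1 (h.abs_cross_le (by positivity) hε e4 e5)
    have hV : 0 ≤ V := le_trans (by positivity) h.V0
    have h2 : 0 ≤ a * k * V := by have := h.k0; positivity
    have h3 : a * k * V ≤ a * (3 * c ^ 2) * V := by have := h.k1; gcongr
    constructor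
    · linarith [h1.1]
    · rw [hA]; linarith [h1.2]
  refine ⟨a, ε, μ / (2 * K1), A * c + c ^ 2 * jM / Real.sqrt jm, A + 1 / 2, ha0.le, hε,
    by positivity, by positivity, by positivity, hL, ?_⟩
  intro x s w D V X k V' X' β Q h hw hD
  obtain ⟨hL1, hL2⟩ := hL x s V X k h.toEnergyBounds
  set L := (1 + a * k) * V + ε * X with hLdef
  have hx := h.x0
  have hs := h.s0
  have hk := h.k0
  have hβ := h.β0
  have hQ := h.Q0
  have hV : 0 ≤ V := le_trans (by positivity) h.V0
  have hLn : 0 ≤ L := by linarith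
  have hAk : 1 ≤ 1 + a * k := by have : 0 ≤ a * k := by positivity
                                 linarith
  have hAk' : 1 + a * k ≤ A := by
    have : a * k ≤ a * (3 * c ^ 2) := by have := h.k1; gcongr
    rw [hA]; linarith
  have f1 : (1 + a * k) * V' ≤ -km * x ^ 2 + A * (c * s * D) - Q / 2 := by
    have i1 := mul_le_mul_of_nonneg_left h.dV (zero_le_one.trans hAk)
    have i2 : km * x ^ 2 ≤ (1 + a * k) * (km * x ^ 2) := le_mul_of_one_le_left (by positivity) hAk
    have i3 : Q / 2 ≤ (1 + a * k) * (Q / 2) := le_mul_of_one_le_left (by positivity) hAk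
    have i4 : (1 + a * k) * (c * s * D) ≤ A * (c * s * D) := by gcongr
    linarith
  have f2 : β * (jM * x) ^ 2 / 2 ≤ a * β * V := by
    have i1 : a * β * (jm / 2 * x ^ 2) ≤ a * β * V := by
      apply mul_le_mul_of_nonneg_left _ (by positivity)
      linarith [h.sq_err_le]
    have i2 : a * β * (jm / 2 * x ^ 2) = β * (jM * x) ^ 2 / 2 := by rw [ha]; field_simp
    linarith
  have f3 : ε * X' ≤ km / 4 * x ^ 2 + c ^ 2 * jM * (x * D) + (ε * s ^ 2 / 2 + km / 4 * x ^ 2)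
      - ε * s ^ 2 + Q / 2 + β * (jM * x) ^ 2 / 2 := by
    have i0 := mul_le_mul_of_nonneg_left h.dX hε.le
    have i1 := mul_le_mul_of_nonneg_right e2 (sq_nonneg x)
    have i2 : ε * (c ^ 2 * D * (jM * x)) ≤ 1 * (c ^ 2 * D * (jM * x)) := by
      gcongr; linarith
    have i3 : ε * (Q / 2) ≤ 1 * (Q / 2) := by gcongr; linarith
    have i4 : ε * (β * (jM * x) ^ 2 / 2) ≤ 1 * (β * (jM * x) ^ 2 / 2) := by gcongr; linarith
    have i5 : c * s * (jM * w * x + kM * x + 0) ≤ M * (s * x) := by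
      rw [hM]
      have : c * s * (jM * w * x + kM * x + 0) ≤ c * s * (jM * W * x + kM * x + 0) := by gcongr
      linarith
    have i6 := mul_le_mul_of_nonneg_left i5 hε.le
    have i7 : M * (s * x) ≤ s ^ 2 / 2 + M ^ 2 * x ^ 2 / 2 := by
      linarith [mul_le_half_sq_add s (M * x), mul_pow M x 2]
    have i8 := mul_le_mul_of_nonneg_left i7 hε.le
    have i9 := mul_le_mul_of_nonneg_right e3 (sq_nonneg x)
    linarith
  -- The `Q` terms of `f1` and `f3` cancel, and `f2` removes the `β` term.
  have f4 : (1 + a * k) * V' - a * β * V + ε * X' ≤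
      -(km / 2) * x ^ 2 - ε / 2 * s ^ 2 + (A * c * s + c ^ 2 * jM * x) * D := by
    linarith
  have f5 : μ * x ^ 2 ≤ km / 2 * x ^ 2 := by gcongr; exact min_le_left _ _
  have f6 : μ * s ^ 2 ≤ ε / 2 * s ^ 2 := by gcongr; exact min_le_right _ _
  have f7 : L ≤ K1 * (x ^ 2 + s ^ 2) := by
    have i1 : V ≤ (jM + 1) / 2 * (x ^ 2 + s ^ 2) := h.energy_le hjM.le
    have i2 := mul_le_mul_of_nonneg_left i1 (by positivity : 0 ≤ A + 1 / 2)
    rw [hK1]; linarith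
  have f8 : 2 * (μ / (2 * K1)) * L ≤ μ * (x ^ 2 + s ^ 2) := by
    have i1 := mul_le_mul_of_nonneg_left f7 (by positivity : 0 ≤ 2 * (μ / (2 * K1)))
    have i2 : 2 * (μ / (2 * K1)) * (K1 * (x ^ 2 + s ^ 2)) = μ * (x ^ 2 + s ^ 2) := by field_simp
    linarith
  have f9 : s ≤ 2 * Real.sqrt L := by
    apply le_of_sq_le_sq _ (by positivity)
    rw [mul_pow, Real.sq_sqrt hLn]
    linarith [h.sq_int_le hjm.le]
  have f10 : x ≤ 2 * Real.sqrt L / Real.sqrt jm := by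
    rw [le_div_iff₀ (Real.sqrt_pos.2 hjm)]
    apply le_of_sq_le_sq _ (by positivity)
    rw [mul_pow, mul_pow, Real.sq_sqrt hLn, Real.sq_sqrt hjm.le]
    linarith [h.sq_err_le]
  have f11 : (A * c * s + c ^ 2 * jM * x) * D ≤
      2 * Real.sqrt L * ((A * c + c ^ 2 * jM / Real.sqrt jm) * D) := by
    calc (A * c * s + c ^ 2 * jM * x) * D
        ≤ (A * c * (2 * Real.sqrt L) + c ^ 2 * jM * (2 * Real.sqrt L / Real.sqrt jm)) * D := by
          gcongr
      _ = _ := by ring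
  linarith

set_option maxHeartbeats 1000000 in
/-- A Lyapunov function showing ultimate boundedness under bounded disturbances. -/
theorem exists_ultimate_lyapunov {jm jM km kM c R D₀ : ℝ} (hjm : 0 < jm) (hjM : 0 < jM)
    (hkm : 0 < km) (hkM : 0 < kM) (hc : 0 < c) (hR : 0 ≤ R) :
    ∃ a ε m A : ℝ, 0 ≤ a ∧ 0 < ε ∧ 0 < m ∧ 0 < A ∧
      (∀ x s V X k ρ : ℝ, EnergyBounds jm jM c x s V X k → 0 ≤ ρ →
        ρ ^ 2 = (1 + a * k) * (1 + V) →
        V ≤ 2 * (ρ ^ 3 + ε * X) ∧ ρ ^ 3 + ε * X ≤ A * (1 + V) ^ 2) ∧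
      ∀ x s w dn V X k V' X' β Q ρ : ℝ, EnergyIneq jm jM km kM c x s w dn 0 V X k V' X' β Q →
        0 ≤ ρ → ρ ^ 2 = (1 + a * k) * (1 + V) → w ≤ x + R → dn ≤ D₀ → m < ρ ^ 3 + ε * X →
        3 / 2 * ρ * ((1 + a * k) * V' - a * β * (1 + V)) + ε * X' ≤ -1 := by
  set M := c * (jM * R + kM) with hM
  have hM0 : 0 < M := by positivity
  -- The last condition is new: it controls the cubic term `ε c jM s x²` that appears when `w` is
  -- bounded only by `x + R`.
  obtain ⟨ε, hε, hl⟩ := exists_pos_mul_le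
    [(1, 1), (jM, km / 4), (M ^ 2, km / 4), (c * jM, 1 / 2), (c * jM, jm / 2), (c * jM, km / 8)]
    (by
      simp only [List.mem_cons, List.not_mem_nil, or_false]
      rintro x (rfl | rfl | rfl | rfl | rfl | rfl) <;> constructor <;> dsimp only <;> positivity)
  simp only [List.mem_cons, List.not_mem_nil, or_false, forall_eq_or_imp, forall_eq] at hl
  obtain ⟨e1, e2, e3, e4, e5, e6⟩ := hl
  set a := jM ^ 2 / jm with ha
  set A := 1 + 3 * a * c ^ 2 with hA
  have ha0 : 0 < a := by positivity
  have hA0 : 1 ≤ A := by rw [hA]; have : 0 ≤ 3 * a * c ^ 2 := by positivity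
                         linarith
  set B := 3 / 2 * (A * (D₀ ^ 2 / km)) + c ^ 2 * D₀ ^ 2 with hB
  have hB0 : 0 ≤ B := by positivity
  set μ := min (3 / 8 * km) (ε / 2) with hμ
  have hμ0 : 0 < μ := by positivity
  set ν := 2 * μ / (A * (jM + 1)) with hν
  have hν0 : 0 < ν := by positivity
  -- For `ρ > r` the quadratic gain `ν ρ²` exceeds all disturbance terms, which grow only linearly
  -- in `ρ`, by at least one.
  set r := max 1 ((B + ν * A + 1) / ν) with hr
  have hr1 : 1 ≤ r := le_max_left _ _
  have base : ∀ x s V X k ρ : ℝ, EnergyBounds jm jM c x s V X k → 0 ≤ ρ →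
      ρ ^ 2 = (1 + a * k) * (1 + V) →
      0 ≤ V ∧ 1 ≤ ρ ∧ 1 + a * k ≤ A ∧ 1 ≤ 1 + a * k ∧ ρ ^ 2 ≤ A * (1 + V) ∧ 1 + V ≤ ρ ^ 2 ∧
        ρ ^ 2 ≤ ρ ^ 3 ∧ |ε * X| ≤ V / 2 := by
    intro x s V X k ρ h hρ hρV
    have hV : 0 ≤ V := le_trans (by positivity) h.V0
    have hAk : 1 ≤ 1 + a * k := by have := h.k0
                                   have : 0 ≤ a * k := by positivity
                                   linarith
    have hAk' : 1 + a * k ≤ A := by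
      have : a * k ≤ a * (3 * c ^ 2) := by have := h.k1; gcongr
      rw [hA]; linarith
    have h1 : 1 + V ≤ ρ ^ 2 := by rw [hρV]; exact le_mul_of_one_le_left (by linarith) hAk
    have h2 : 1 ≤ ρ := by nlinarith
    refine ⟨hV, h2, hAk', hAk, ?_, h1, ?_, h.abs_cross_le (by positivity) hε e4 e5⟩
    · rw [hρV]; gcongr
    · exact pow_le_pow_right₀ h2 (by norm_num)
  refine ⟨a, ε, 2 * r ^ 3, 2 * A ^ 2, ha0.le, hε, by positivity, by positivity, ?_, ?_⟩
  · intro x s V X k ρ h hρ hρV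
    obtain ⟨hV, hρ1, hAk', hAk, hA1, hV1, h23, hX⟩ := base x s V X k ρ h hρ hρV
    obtain ⟨hX1, hX2⟩ := abs_le.1 hX
    refine ⟨by linarith, ?_⟩
    have h34 : ρ ^ 3 ≤ ρ ^ 4 := pow_le_pow_right₀ hρ1 (by norm_num)
    have h4 : ρ ^ 4 ≤ (A * (1 + V)) ^ 2 := by
      have : ρ ^ 4 = (ρ ^ 2) ^ 2 := by ring
      rw [this]; gcongr
    have h5 : V / 2 ≤ (A * (1 + V)) ^ 2 := by linarith
    linarith [mul_pow A (1 + V) 2]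
  · intro x s w dn V X k V' X' β Q ρ h hρ hρV hw hdn hm
    obtain ⟨hV, hρ1, hAk', hAk, hA1, hV1, h23, hX⟩ := base x s V X k ρ h.toEnergyBounds hρ hρV
    obtain ⟨hX1, hX2⟩ := abs_le.1 hX
    have hx := h.x0
    have hs := h.s0
    have hk := h.k0
    have hβ := h.β0
    have hQ := h.Q0
    -- The level `2 r³` suffices because `ε X ≤ V/2 ≤ ρ³`.
    have hρr : r < ρ := by
      apply lt_of_pow_lt_pow_left₀ 3 hρ
      linarith
    have f1 : (1 + a * k) * V' ≤ -(3 / 4 * km) * x ^ 2 + A * (D₀ ^ 2 / km) - Q / 2 := by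
      have i0 : x * dn ≤ km / 4 * x ^ 2 + D₀ ^ 2 / km := by
        have j1 : x * dn ≤ x * D₀ := by gcongr
        have j2 : km / 4 * x ^ 2 + D₀ ^ 2 / km - x * D₀ = (km * x / 2 - D₀) ^ 2 / km := by
          field_simp; ring
        have j3 : 0 ≤ (km * x / 2 - D₀) ^ 2 / km := by positivity
        linarith
      have i1 := mul_le_mul_of_nonneg_left h.dV (zero_le_one.trans hAk)
      have i2 : 3 / 4 * km * x ^ 2 ≤ (1 + a * k) * (3 / 4 * km * x ^ 2) :=
        le_mul_of_one_le_left (by positivity) hAk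
      have i3 : Q / 2 ≤ (1 + a * k) * (Q / 2) := le_mul_of_one_le_left (by positivity) hAk
      have i4 : (1 + a * k) * (D₀ ^ 2 / km) ≤ A * (D₀ ^ 2 / km) := by gcongr
      have i5 := mul_le_mul_of_nonneg_left i0 (zero_le_one.trans hAk)
      linarith
    have f2 : β * (jM * x) ^ 2 / 2 ≤ a * β * (1 + V) := by
      have i1 : a * β * (jm / 2 * x ^ 2) ≤ a * β * (1 + V) := by
        apply mul_le_mul_of_nonneg_left _ (by positivity)
        linarith [h.sq_err_le]
      have i2 : a * β * (jm / 2 * x ^ 2) = β * (jM * x) ^ 2 / 2 := by rw [ha]; field_simp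
      linarith
    -- Differentiating the cube multiplies the dissipation by `ρ`; the resulting `-ρ x²` is what can
    -- beat `s x²`.
    have f3 : 3 / 2 * ρ * ((1 + a * k) * V' - a * β * (1 + V)) ≤
        -(9 / 8 * km) * (ρ * x ^ 2) + 3 / 2 * (A * (D₀ ^ 2 / km)) * ρ - Q / 2
          - β * (jM * x) ^ 2 / 2 := by
      have i1 := mul_le_mul_of_nonneg_left f1 (by positivity : 0 ≤ 3 / 2 * ρ)
      have i2 := mul_le_mul_of_nonneg_left f2 (by positivity : 0 ≤ 3 / 2 * ρ)
      have i3 : 1 * (Q / 2) ≤ 3 / 2 * ρ * (Q / 2) := by gcongr; linarith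
      have i4 : 1 * (β * (jM * x) ^ 2 / 2) ≤ 3 / 2 * ρ * (β * (jM * x) ^ 2 / 2) := by
        gcongr; linarith
      linarith
    have hxρ : x ^ 2 ≤ ρ * x ^ 2 := le_mul_of_one_le_left (sq_nonneg x) hρ1
    have f4 : ε * X' ≤ km / 4 * (ρ * x ^ 2) + (km / 4 * (ρ * x ^ 2) + (ε * s ^ 2 / 4
        + km / 4 * (ρ * x ^ 2)) + (ε * s ^ 2 / 4 + c ^ 2 * D₀ ^ 2)) - ε * s ^ 2 + Q / 2
        + β * (jM * x) ^ 2 / 2 := by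
      have i0 := mul_le_mul_of_nonneg_left h.dX hε.le
      have i1 : ε * jM * x ^ 2 ≤ km / 4 * (ρ * x ^ 2) := by gcongr
      have i3 : ε * (Q / 2) ≤ 1 * (Q / 2) := by gcongr; linarith
      have i4 : ε * (β * (jM * x) ^ 2 / 2) ≤ 1 * (β * (jM * x) ^ 2 / 2) := by gcongr; linarith
      have i5 : c * s * (jM * w * x + kM * x + dn) ≤
          c * jM * (s * x ^ 2) + M * (s * x) + c * (s * D₀) := by
        rw [hM]
        have : c * s * (jM * w * x + kM * x + dn) ≤
          c * s * (jM * (x + R) * x + kM * x + D₀) := by gcongr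
        linarith
      have i6 := mul_le_mul_of_nonneg_left i5 hε.le
      -- This turns the cubic term into a small multiple of `ρ x²`.
      have hsρ : s ≤ 2 * ρ := by
        apply le_of_sq_le_sq _ (by positivity)
        linarith [h.sq_int_le hjm.le, mul_pow 2 ρ 2]
      have i7 : ε * (c * jM) * (s * x ^ 2) ≤ km / 8 * (2 * ρ * x ^ 2) := by gcongr
      have i8 : M * (s * x) ≤ s ^ 2 / 4 + M ^ 2 * x ^ 2 := by
        linarith [mul_le_quarter_sq_add s (M * x), mul_pow M x 2]
      have i9 := mul_le_mul_of_nonneg_left i8 hε.le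
      have i10 : ε * M ^ 2 * x ^ 2 ≤ km / 4 * (ρ * x ^ 2) := by gcongr
      have i11 : c * (s * D₀) ≤ s ^ 2 / 4 + c ^ 2 * D₀ ^ 2 := by
        linarith [mul_le_quarter_sq_add s (c * D₀), mul_pow c D₀ 2]
      have i12 := mul_le_mul_of_nonneg_left i11 hε.le
      have i13 : ε * (c ^ 2 * D₀ ^ 2) ≤ 1 * (c ^ 2 * D₀ ^ 2) := by gcongr; linarith
      linarith
    have f5 : μ * x ^ 2 ≤ 3 / 8 * km * (ρ * x ^ 2) := by gcongr; exact min_le_left _ _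
    have f6 : μ * s ^ 2 ≤ ε / 2 * s ^ 2 := by gcongr; exact min_le_right _ _
    have f7 : ν * ρ ^ 2 ≤ ν * A + μ * (x ^ 2 + s ^ 2) := by
      have i1 : V ≤ (jM + 1) / 2 * (x ^ 2 + s ^ 2) := h.energy_le hjM.le
      have i2 : ρ ^ 2 ≤ A * (1 + (jM + 1) / 2 * (x ^ 2 + s ^ 2)) := hA1.trans (by gcongr)
      have i3 := mul_le_mul_of_nonneg_left i2 hν0.le
      have i4 : ν * (A * (1 + (jM + 1) / 2 * (x ^ 2 + s ^ 2))) =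
          ν * A + μ * (x ^ 2 + s ^ 2) := by rw [hν]; field_simp
      linarith
    have f8 : (B + ν * A + 1) * ρ ≤ ν * ρ ^ 2 := by
      have i1 : (B + ν * A + 1) / ν ≤ ρ := (le_max_right _ _).trans hρr.le
      rw [div_le_iff₀ hν0] at i1
      have := mul_le_mul_of_nonneg_right i1 hρ
      linarith
    have f9 : (ν * A + 1) * 1 ≤ (ν * A + 1) * ρ := by gcongr
    have f10 : c ^ 2 * D₀ ^ 2 * 1 ≤ c ^ 2 * D₀ ^ 2 * ρ := by gcongr
    have f11 : B * ρ = 3 / 2 * (A * (D₀ ^ 2 / km)) * ρ + c ^ 2 * D₀ ^ 2 * ρ := by rw [hB]; ring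
    linarith

/-! ### Stability estimates for trajectories of the error system. -/

namespace GainBounds

variable {J Km : M3} {KI : ℝ → M3} {jm jM km kM c : ℝ}

theorem energyBounds (G : GainBounds J Km KI jm jM km kM c) (e z : ℝ → V3) {t : ℝ} (ht : 0 ≤ t) :
    EnergyBounds jm jM c ‖e t‖ (Real.sqrt (weightedSq KI z t)) (energy J KI e z t)
      (crossEnergy J KI e z t) (gainInv KI t) where
  x0 := norm_nonneg _
  s0 := Real.sqrt_nonneg _
  k0 := G.gainInv_nonneg ht
  k1 := G.gainInv_le ht
  V0 := by rw [Real.sq_sqrt (G.weightedSq_nonneg z ht)]; exact G.energy_lower e z t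
  V1 := by rw [Real.sq_sqrt (G.weightedSq_nonneg z ht)]; exact G.energy_upper e z t
  X1 := G.abs_crossEnergy_le e z ht

theorem energy_nonneg (G : GainBounds J Km KI jm jM km kM c) (e z : ℝ → V3) {t : ℝ}
    (ht : 0 ≤ t) : 0 ≤ energy J KI e z t := by
  have h := G.energyBounds e z ht
  have := G.jm_pos
  exact le_trans (by positivity) h.V0

theorem norm_le_sqrt_energy (G : GainBounds J Km KI jm jM km kM c) (e z : ℝ → V3) {t : ℝ}
    (ht : 0 ≤ t) : ‖e t‖ ≤ Real.sqrt (2 / jm) * Real.sqrt (energy J KI e z t) := by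
  have h := (G.energyBounds e z ht).sq_err_le
  have hj := G.jm_pos
  rw [← Real.sqrt_mul (by positivity)]
  apply Real.le_sqrt_of_sq_le
  rw [div_mul_eq_mul_div, le_div_iff₀ hj]
  linarith

theorem sqrt_energy_le (G : GainBounds J Km KI jm jM km kM c) (e z : ℝ → V3) {t : ℝ}
    (ht : 0 ≤ t) : Real.sqrt (energy J KI e z t) ≤ (jM + 1 + c) * (‖e t‖ + ‖z t‖) := by
  have h1 := G.energy_upper e z t
  have h2 := G.weightedSq_le z ht
  have hj := G.jM_pos
  have hc := G.c_pos
  apply Real.sqrt_le_iff.2 ⟨by positivity, ?_⟩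
  have hx := norm_nonneg (e t)
  have hz := norm_nonneg (z t)
  have h3 : (jM / 2) * ‖e t‖ ^ 2 + 1 / 2 * (c ^ 2 * ‖z t‖ ^ 2) ≤
      ((jM + 1) * ‖e t‖ + c * ‖z t‖) ^ 2 := by
    have : 0 ≤ jM ^ 2 * ‖e t‖ ^ 2 := by positivity
    have : 0 ≤ jM * ‖e t‖ ^ 2 := by positivity
    have : 0 ≤ (c * ‖z t‖) ^ 2 := by positivity
    have : 0 ≤ (jM + 1) * ‖e t‖ * (c * ‖z t‖) := by positivity
    nlinarith [sq_nonneg ‖e t‖]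
  have h4 : (jM + 1) * ‖e t‖ + c * ‖z t‖ ≤ (jM + 1 + c) * (‖e t‖ + ‖z t‖) := by
    have : 0 ≤ c * ‖e t‖ := by positivity
    have : 0 ≤ (jM + 1) * ‖z t‖ := by positivity
    linarith
  have h5 := pow_le_pow_left₀ (by positivity) h4 2
  linarith

end GainBounds

namespace ErrorSystem

variable {J Km : M3} {KI : ℝ → M3} {jm jM km kM c : ℝ} {wh e z d δ : ℝ → V3}

theorem exists_ineq (S : ErrorSystem J Km KI wh e z d δ)
    (G : GainBounds J Km KI jm jM km kM c) {t : ℝ} (ht : 0 < t) :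
    ∃ V' X' β Q : ℝ, HasDerivAt (energy J KI e z) V' t ∧ HasDerivAt (crossEnergy J KI e z) X' t ∧
      HasDerivAt (gainInv KI) (-β) t ∧
      EnergyIneq jm jM km kM c ‖e t‖ (Real.sqrt (weightedSq KI z t)) ‖wh t‖ ‖d t‖ ‖δ t‖
        (energy J KI e z t) (crossEnergy J KI e z t) (gainInv KI t) V' X' β Q := by
  obtain ⟨V', X', β, Q, h1, h2, h3, h4, h5, h6, h7⟩ := S.exists_derivs G ht
  refine ⟨V', X', β, Q, h1, h2, h3, ⟨G.energyBounds e z ht.le, h4, h5, h6, ?_⟩⟩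
  rwa [Real.sq_sqrt (G.weightedSq_nonneg z ht.le)]

end ErrorSystem

namespace GainBounds

variable {J Km : M3} {KI : ℝ → M3} {jm jM km kM c : ℝ}

/-- Lyapunov functions for the error system driven by the rate of the disturbance, as long as the
angular velocity is bounded by `W`. -/
theorem exists_lyapunov_function (G : GainBounds J Km KI jm jM km kM c) {W : ℝ} (hW : 0 ≤ W) :
    ∃ lam γ K : ℝ, 0 < lam ∧ 0 < γ ∧ 0 < K ∧ ∀ wh e z d δ : ℝ → V3,
      ErrorSystem J Km KI wh e z d δ → (∀ t, 0 < t → d t = 0) →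
      ∃ F F' : ℝ → ℝ, ContinuousOn F (Ici 0) ∧ (∀ t, 0 < t → HasDerivAt F (F' t) t) ∧
        (∀ t, 0 ≤ t → energy J KI e z t ≤ 2 * F t ∧ F t ≤ K * energy J KI e z t) ∧
        ∀ t, 0 < t → ‖wh t‖ ≤ W →
          F' t ≤ -(2 * lam) * F t + 2 * Real.sqrt (F t) * (γ * ‖δ t‖) := by
  obtain ⟨a, ε, lam, γ, K, ha, hε, hlam, hγ, hK, hb, hd⟩ :=
    exists_lyapunov G.jm_pos G.jM_pos G.km_pos G.kM_pos G.c_pos hW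
  refine ⟨lam, γ, K, hlam, hγ, hK, fun wh e z d δ S hd0 => ?_⟩
  -- The derivative is packaged as a total function by choice; its value at nonpositive times is
  -- irrelevant.
  have hex : ∀ t, ∃ F' : ℝ, 0 < t →
      HasDerivAt (fun t => (1 + a * gainInv KI t) * energy J KI e z t
        + ε * crossEnergy J KI e z t) F' t ∧ (‖wh t‖ ≤ W → F' ≤ -(2 * lam) *
          ((1 + a * gainInv KI t) * energy J KI e z t + ε * crossEnergy J KI e z t) +
          2 * Real.sqrt ((1 + a * gainInv KI t) * energy J KI e z t
            + ε * crossEnergy J KI e z t) * (γ * ‖δ t‖)) := by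
    intro t
    by_cases ht : 0 < t
    · obtain ⟨V', X', β, Q, h1, h2, h3, h4⟩ := S.exists_ineq G ht
      rw [hd0 t ht, norm_zero] at h4
      refine ⟨_, fun _ => ⟨(((h3.const_mul a).const_add 1).fun_mul h1).fun_add (h2.const_mul ε),
        fun hw => ?_⟩⟩
      have := hd _ _ _ _ _ _ _ _ _ _ _ h4 hw (norm_nonneg _)
      linarith
    · exact ⟨0, fun h => absurd h ht⟩
  choose F' hF' using hex
  refine ⟨_, F', ?_, fun t ht => (hF' t ht).1, fun t ht => ?_, fun t ht => (hF' t ht).2⟩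
  · exact ((continuousOn_const.add (continuousOn_const.mul G.continuousOn_gainInv)).mul
      (S.continuousOn_energy G)).add (continuousOn_const.mul (S.continuousOn_crossEnergy G))
  · obtain ⟨h1, h2⟩ := hb _ _ _ _ _ (G.energyBounds e z ht)
    exact ⟨by linarith, h2⟩

/-- Input-to-state stability of the error system. -/
theorem exists_energy_decay (G : GainBounds J Km KI jm jM km kM c) {W : ℝ} (hW : 0 ≤ W) :
    ∃ lam γ C : ℝ, 0 < lam ∧ 0 < γ ∧ 0 < C ∧ ∀ wh e z d δ : ℝ → V3,
      ErrorSystem J Km KI wh e z d δ → (∀ t, 0 < t → d t = 0) → ∀ a b D : ℝ, 0 ≤ a → a ≤ b →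
      0 ≤ D → (∀ t ∈ Ioo a b, ‖wh t‖ ≤ W) → (∀ t ∈ Ioo a b, ‖δ t‖ ≤ D) →
      Real.sqrt (energy J KI e z b) ≤
        C * Real.exp (-lam * (b - a)) * Real.sqrt (energy J KI e z a) + γ * D := by
  obtain ⟨lam, γ, K, hlam, hγ, hK, h⟩ := G.exists_lyapunov_function hW
  refine ⟨lam, Real.sqrt 2 * (γ / lam), Real.sqrt 2 * Real.sqrt K, hlam, by positivity,
    by positivity, fun wh e z d δ S hd0 a b D ha hab hD hw hδ => ?_⟩
  obtain ⟨F, F', hF, hF', hFV, hle⟩ := h wh e z d δ S hd0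
  have hF0 : ∀ t, 0 ≤ t → 0 ≤ F t := fun t ht => by
    have := G.energy_nonneg e z ht
    have := (hFV t ht).1
    linarith
  -- The input is only bounded by a constant here, so the exponentially decaying part is switched
  -- off by `A = 0`.
  have key := sqrt_comparison (F := F) (F' := F') (g := fun t => γ * ‖δ t‖) (mu := 0) (A := 0)
    (D := γ * D) hab hlam hlam (hF.mono fun x hx => ha.trans hx.1)
    (fun t ht => hF' t (ha.trans_lt ht.1)) (fun t ht => hF0 t (ha.trans ht.1))
    (fun t ht => hle t (ha.trans_lt ht.1) (hw t ht)) (fun t _ => by positivity)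
    (fun t ht => by
      rw [zero_mul, zero_add]
      exact mul_le_mul_of_nonneg_left (hδ t ht) hγ.le) le_rfl (by positivity)
  have h1 : Real.sqrt (energy J KI e z b) ≤ Real.sqrt 2 * Real.sqrt (F b) := by
    rw [← Real.sqrt_mul (by norm_num)]
    exact Real.sqrt_le_sqrt (hFV b (ha.trans hab)).1
  have h2 : Real.sqrt (F a) ≤ Real.sqrt K * Real.sqrt (energy J KI e z a) := by
    rw [← Real.sqrt_mul hK.le]
    exact Real.sqrt_le_sqrt (hFV a ha).2
  have h3 := mul_le_mul_of_nonneg_left h2 (Real.exp_pos (-lam * (b - a))).le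
  have h4 := mul_le_mul_of_nonneg_left (key.trans (add_le_add_left (add_le_add_left h3 _) _))
    (Real.sqrt_nonneg 2)
  calc _ ≤ _ := h1.trans h4
    _ = _ := by ring

/-- Finite-gain `L^p` stability of the error system. -/
theorem exists_energy_eLpNorm (G : GainBounds J Km KI jm jM km kM c) {W : ℝ} (hW : 0 ≤ W) :
    ∃ γ C : ℝ, 0 < γ ∧ 0 < C ∧ ∀ wh e z d δ : ℝ → V3,
      ErrorSystem J Km KI wh e z d δ → (∀ t, 0 < t → d t = 0) →
      (∀ t, 0 ≤ t → ‖wh t‖ ≤ W) → StronglyMeasurable δ → ∀ (p : ℝ≥0∞) (T : ℝ), 1 ≤ p → 0 ≤ T →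
      eLpNorm e p (volume.restrict (Icc 0 T)) ≤
        ENNReal.ofReal (C * (‖e 0‖ + ‖z 0‖))
          + ENNReal.ofReal γ * eLpNorm δ p (volume.restrict (Icc 0 T)) := by
  obtain ⟨lam, γ, K, hlam, hγ, hK, h⟩ := G.exists_lyapunov_function hW
  have hjm := G.jm_pos
  have hjM := G.jM_pos
  have hc := G.c_pos
  set B := Real.sqrt (2 / jm) * Real.sqrt 2 with hB
  have hB0 : 0 < B := by positivity
  refine ⟨B * (1 / lam) * γ, B * ((1 + 1 / lam) * (Real.sqrt K * (jM + 1 + c))), by positivity,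
    by positivity, fun wh e z d δ S hd0 hw hδ p T hp hT => ?_⟩
  obtain ⟨F, F', hF, hF', hFV, hle⟩ := h wh e z d δ S hd0
  have hF0 : ∀ t, 0 ≤ t → 0 ≤ F t := fun t ht => by
    have := G.energy_nonneg e z ht
    have := (hFV t ht).1
    linarith
  have key := eLpNorm_sqrt_le (F := F) (F' := F') (g := fun t => γ * ‖δ t‖) hT hlam hp
    (hF.mono fun x hx => hx.1) (fun t ht => hF' t ht.1) (fun t ht => hF0 t ht.1)
    (fun t ht => hle t ht.1 (hw t ht.1.le)) (fun t => by positivity)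
    ((hδ.norm.const_mul γ).aestronglyMeasurable)
  have h1 : eLpNorm e p (volume.restrict (Icc 0 T)) ≤
      ENNReal.ofReal B * eLpNorm (fun t => Real.sqrt (F t)) p (volume.restrict (Icc 0 T)) := by
    apply eLpNorm_le_mul_eLpNorm_of_ae_le_mul
    filter_upwards [ae_restrict_mem measurableSet_Icc] with t ht
    rw [Real.norm_of_nonneg (Real.sqrt_nonneg _), hB, mul_assoc]
    refine (G.norm_le_sqrt_energy e z ht.1).trans ?_
    gcongr
    rw [← Real.sqrt_mul (by norm_num)]
    exact Real.sqrt_le_sqrt (hFV t ht.1).1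
  have h2 : eLpNorm (fun t => γ * ‖δ t‖) p (volume.restrict (Icc 0 T)) =
      ENNReal.ofReal γ * eLpNorm δ p (volume.restrict (Icc 0 T)) := by
    have : (fun t => γ * ‖δ t‖) = γ • fun t => ‖δ t‖ := by ext; simp
    rw [this, eLpNorm_const_smul, eLpNorm_norm, Real.enorm_eq_ofReal hγ.le]
  have h3 : Real.sqrt (F 0) ≤ Real.sqrt K * (jM + 1 + c) * (‖e 0‖ + ‖z 0‖) := by
    rw [mul_assoc]
    refine le_trans ?_ (mul_le_mul_of_nonneg_left (G.sqrt_energy_le e z le_rfl)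
      (Real.sqrt_nonneg K))
    rw [← Real.sqrt_mul hK.le]
    exact Real.sqrt_le_sqrt (hFV 0 le_rfl).2
  calc eLpNorm e p (volume.restrict (Icc 0 T))
      ≤ ENNReal.ofReal B * (ENNReal.ofReal ((1 + 1 / lam) *
          (Real.sqrt K * (jM + 1 + c) * (‖e 0‖ + ‖z 0‖))) + ENNReal.ofReal (1 / lam) *
          (ENNReal.ofReal γ * eLpNorm δ p (volume.restrict (Icc 0 T)))) := by
        rw [h2] at key
        refine h1.trans ?_
        gcongr
        refine key.trans ?_
        gcongr
    _ = _ := by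
        rw [mul_add, ← mul_assoc (ENNReal.ofReal (1 / lam)), ← mul_assoc (ENNReal.ofReal B),
          ← ENNReal.ofReal_mul hB0.le, ← ENNReal.ofReal_mul (by positivity),
          ← ENNReal.ofReal_mul hB0.le]
        congr 2 <;> first | ring1 | (congr 1; ring1)

/-- Boundedness and ultimate boundedness of the energy under bounded disturbances. -/
theorem exists_ultimate_bound (G : GainBounds J Km KI jm jM km kM c) {R : ℝ} (hR : 0 ≤ R)
    (D₀ : ℝ) :
    ∃ Vs : ℝ, 0 < Vs ∧ ∀ r : ℝ, ∃ T B : ℝ, 0 ≤ T ∧ 0 ≤ B ∧ ∀ wh e z d δ : ℝ → V3,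
      ErrorSystem J Km KI wh e z d δ → (∀ t, 0 < t → δ t = 0) → (∀ t, 0 < t → ‖d t‖ ≤ D₀) →
      (∀ t, 0 < t → ‖wh t‖ ≤ ‖e t‖ + R) → energy J KI e z 0 ≤ r →
      ∀ t, 0 ≤ t → energy J KI e z t ≤ B ∧ (T ≤ t → energy J KI e z t ≤ Vs) := by
  obtain ⟨a, ε, m, A, ha, hε, hm, hA, hb, hd⟩ :=
    exists_ultimate_lyapunov G.jm_pos G.jM_pos G.km_pos G.kM_pos G.c_pos hR (D₀ := D₀)
  -- `A * (1 + r) ^ 2` bounds the initial value of `L`; at unit rate of decrease it also bounds the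
  -- time needed to reach the level `m`. Since `V ≤ 2 L`, the final bound `2 * m` does not involve
  -- `r`.
  refine ⟨2 * m, by positivity, fun r => ⟨A * (1 + r) ^ 2, 2 * max m (A * (1 + r) ^ 2),
    by positivity, by positivity, fun wh e z d δ S hδ0 hd0 hw hr => ?_⟩⟩
  -- The shift `1 + V` keeps `U` positive, so its square root is differentiable.
  set U : ℝ → ℝ := fun t => (1 + a * gainInv KI t) * (1 + energy J KI e z t) with hU
  have hUpos : ∀ t, 0 ≤ t → 0 < U t := fun t ht => by
    have := G.gainInv_nonneg ht
    have := G.energy_nonneg e z ht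
    simp only [hU]; positivity
  set L : ℝ → ℝ := fun t => Real.sqrt (U t) ^ 3 + ε * crossEnergy J KI e z t with hL
  have hρ : ∀ t, 0 ≤ t → Real.sqrt (U t) ^ 2 = U t := fun t ht => Real.sq_sqrt (hUpos t ht).le
  have hcU : ContinuousOn U (Ici 0) :=
    (continuousOn_const.add (continuousOn_const.mul G.continuousOn_gainInv)).mul
      (continuousOn_const.add (S.continuousOn_energy G))
  have hcL : ContinuousOn L (Ici 0) :=
    ((Real.continuous_sqrt.comp_continuousOn hcU).pow 3).add
      (continuousOn_const.mul (S.continuousOn_crossEnergy G))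
  have hex : ∀ t, ∃ L' : ℝ, 0 < t → HasDerivAt L L' t ∧ (m < L t → L' ≤ -1) := by
    intro t
    by_cases ht : 0 < t
    · obtain ⟨V', X', β, Q, h1, h2, h3, h4⟩ := S.exists_ineq G ht
      rw [hδ0 t ht, norm_zero] at h4
      have hdU : HasDerivAt U ((1 + a * gainInv KI t) * V' -
          a * β * (1 + energy J KI e z t)) t :=
        (((h3.const_mul a).const_add 1).fun_mul (h1.const_add 1)).congr_deriv (by ring)
      have hdL := ((hdU.sqrt (hUpos t ht.le).ne').fun_pow 3).fun_add (h2.const_mul ε)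
      refine ⟨_, fun _ => ⟨hdL, fun hm => ?_⟩⟩
      have key := hd _ _ _ _ _ _ _ _ _ _ _ (Real.sqrt (U t)) h4 (Real.sqrt_nonneg _)
        (hρ t ht.le) (hw t ht) (hd0 t ht) hm
      have hs := Real.sqrt_pos.2 (hUpos t ht.le)
      refine le_trans (le_of_eq ?_) key
      norm_num
      field_simp
    · exact ⟨0, fun h => absurd h ht⟩
  choose L' hL' using hex
  intro t ht
  have h1 := le_max_of_hasDerivAt_le_neg_one hcL (fun t ht => (hL' t ht).1)
    (fun t ht => (hL' t ht).2) ht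
  have h2 := (hb _ _ _ _ _ _ (G.energyBounds e z ht) (Real.sqrt_nonneg _) (hρ t ht)).1
  have h3 := (hb _ _ _ _ _ _ (G.energyBounds e z le_rfl) (Real.sqrt_nonneg _) (hρ 0 le_rfl)).2
  have h4 : L 0 ≤ A * (1 + r) ^ 2 := by
    refine h3.trans ?_
    have := G.energy_nonneg e z le_rfl
    gcongr
  change _ ≤ 2 * L t at h2
  constructor
  · have : L t ≤ max m (A * (1 + r) ^ 2) := h1.trans (max_le_max le_rfl (by linarith))
    linarith
  · intro hT
    have : L t ≤ m := h1.trans (max_le le_rfl (by linarith))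
    linarith

end GainBounds

/-! ### From the closed loop to the error system. -/

theorem exists_gainBounds {J Km : M3} {KI : ℝ → M3} (hJ : J.PosDef) (hKm : PosDefForm Km)
    (hKI_diag : ∀ t, 0 ≤ t → (KI t).IsDiag)
    (hKI_pos : ∃ κ : ℝ, 0 < κ ∧ ∀ t, 0 ≤ t → ∀ i, κ ≤ KI t i i)
    (hKI_diff : ∀ t, 0 ≤ t → ∀ i, DifferentiableAt ℝ (fun s => KI s i i) t)
    (hKI_mono : ∀ t, 0 ≤ t → ∀ i, 0 ≤ deriv (fun s => KI s i i) t) :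
    ∃ jm jM km kM c : ℝ, GainBounds J Km KI jm jM km kM c := by
  obtain ⟨jm, hjm, hJl⟩ := (posDefForm_of_posDef hJ).exists_coercive
  obtain ⟨km, hkm, hKl⟩ := hKm.exists_coercive
  obtain ⟨κ, hκ, hKI⟩ := hKI_pos
  have hup : ∀ (A : M3) (x : V3), ‖mv A x‖ ≤ (sigmaMax A + 1) * ‖x‖ := fun A x => by
    have := norm_mv_le A x
    have := norm_nonneg x
    linarith
  refine ⟨jm, sigmaMax J + 1, km, sigmaMax Km + 1, Real.sqrt (1 / κ),
    { jm_pos := hjm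
      jM_pos := by have := sigmaMax_nonneg J; positivity
      km_pos := hkm
      kM_pos := by have := sigmaMax_nonneg Km; positivity
      c_pos := Real.sqrt_pos.2 (by positivity)
      symm := hJ.isHermitian
      J_lower := hJl
      J_upper := hup J
      Km_lower := hKl
      Km_upper := hup Km
      KI_diag := hKI_diag
      KI_pos := fun t ht i => hκ.trans_le (hKI t ht i)
      KI_inv := fun t ht i => ?_
      KI_diff := hKI_diff
      KI_mono := hKI_mono }⟩
  rw [Real.sq_sqrt (by positivity)]
  exact one_div_le_one_div_of_le hκ (hKI t ht i)

/-- The factor `4/(1 + ‖q̂‖²)` from `Z⁻¹` outweighs the linear growth of `Λ(q_d - q̂)`, so the bound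
holds for every measured attitude, bounded or not. -/
theorem exists_norm_omegaR_le (Lam : M3) {qd : ℝ → V3}
    (hqd : ∃ B : ℝ, ∀ t, 0 ≤ t → ‖qd t‖ ≤ B ∧ ‖deriv qd t‖ ≤ B) :
    ∃ R : ℝ, 0 ≤ R ∧ ∀ (qh : ℝ → V3) (t : ℝ), 0 ≤ t → ‖omegaR Lam qd qh t‖ ≤ R := by
  obtain ⟨B, hB⟩ := hqd
  have hB0 : 0 ≤ B := (norm_nonneg _).trans (hB 0 le_rfl).1
  have hσ := sigmaMax_nonneg Lam
  refine ⟨4 * (B + sigmaMax Lam * (B + 1)), by positivity, fun qh t ht => ?_⟩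
  obtain ⟨h1, h2⟩ := hB t ht
  set n := ‖qh t‖ with hn
  have hn0 : 0 ≤ n := norm_nonneg _
  have h3 : ‖mv Lam (qd t - qh t)‖ ≤ sigmaMax Lam * (B + n) :=
    (norm_mv_le _ _).trans (mul_le_mul_of_nonneg_left ((norm_sub_le _ _).trans (by gcongr)) hσ)
  have h4 : ‖omegaR Lam qd qh t‖ ≤ 4 / (1 + n ^ 2) * (B + sigmaMax Lam * (B + n)) := by
    refine (norm_add_le _ _).trans ?_
    rw [norm_mv_mrpZ_inv, norm_mv_mrpZ_inv, ← mul_add]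
    gcongr
  refine h4.trans ?_
  rw [div_mul_eq_mul_div, div_le_iff₀ (by positivity)]
  have h5 : n ≤ 1 + n ^ 2 := by nlinarith [sq_nonneg (n - 1)]
  have h6 : sigmaMax Lam * n ≤ sigmaMax Lam * (1 + n ^ 2) := by gcongr
  have h7 : 0 ≤ (B + sigmaMax Lam * B) * n ^ 2 := by positivity
  linarith

namespace ClosedLoop

variable {J Jh Km Lam : M3} {KI : ℝ → M3} {qd qh w wh dext : ℝ → V3}

theorem differentiableAt_omegaR (H : ClosedLoop J Jh Km Lam KI qd qh w wh dext)
    (hqd : ContDiff ℝ 2 qd) {t : ℝ} (ht : 0 ≤ t) : DifferentiableAt ℝ (omegaR Lam qd qh) t := by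
  have hq := (H.kinematics t ht).differentiableAt
  have hd : DifferentiableAt ℝ qd t := hqd.differentiable (by norm_num) t
  have hd' : DifferentiableAt ℝ (deriv qd) t := by
    have : ContDiff ℝ (1 + 1) qd := by norm_num; exact hqd
    exact (contDiff_succ_iff_deriv.1 this).2.2.differentiable (by norm_num) t
  exact (differentiableAt_mv_mrpZ_inv hq hd').add (differentiableAt_mv_mrpZ_inv hq
    ((hd.sub hq).hasDerivAt.mv Lam).differentiableAt)

theorem differentiableAt_omegaE (H : ClosedLoop J Jh Km Lam KI qd qh w wh dext)
    (hqd : ContDiff ℝ 2 qd) {t : ℝ} (ht : 0 ≤ t) :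
    DifferentiableAt ℝ (omegaE Lam qd qh wh) t :=
  (H.diff_wh t ht).sub (H.differentiableAt_omegaR hqd ht)

/-- The disturbance `d` is defined so that it collects every mismatch between true and measured
velocity and between `J` and `Ĵ`; the rest is as for exact data, where the gyroscopic torque and its
feedforward combine into `S(J ω̂) e`. -/
theorem mv_deriv_omegaE (H : ClosedLoop J Jh Km Lam KI qd qh w wh dext)
    (hqd : ContDiff ℝ 2 qd) {t : ℝ} (ht : 0 ≤ t) :
    mv J (deriv (omegaE Lam qd qh wh) t) =
      mv (skew (mv J (wh t))) (omegaE Lam qd qh wh t) - mv Km (omegaE Lam qd qh wh t)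
        - (∫ s in (0 : ℝ)..t, mv (KI s) (omegaE Lam qd qh wh s))
        + dRes2 J Jh Lam qd qh w wh dext t := by
  have e1 : deriv (omegaE Lam qd qh wh) t = deriv wh t - deriv (omegaR Lam qd qh) t :=
    deriv_sub (H.diff_wh t ht) (H.differentiableAt_omegaR hqd ht)
  have e2 : deriv (fun s => w s - wh s) t = deriv w t - deriv wh t :=
    deriv_sub (H.diff_w t ht) (H.diff_wh t ht)
  have hdyn := H.dynamics t ht
  rw [e1, mv_sub]
  simp only [dRes2, dRes, e2, mv_sub, sub_mv, mv_skew_sub_left, hdyn, controlLaw]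
  have e3 : mv (skew (mv J (wh t))) (omegaE Lam qd qh wh t) =
      mv (skew (mv J (wh t))) (wh t) - mv (skew (mv J (wh t))) (omegaR Lam qd qh t) :=
    mv_sub _ _ _
  rw [e3]
  abel

/-- Since `Z Z⁻¹ = 1`, inserting `ω̂ = e + ω_r` cancels `q̇_d` and leaves a linear filter driven by
`e`. -/
theorem hasDerivAt_attitudeError (H : ClosedLoop J Jh Km Lam KI qd qh w wh dext)
    (hqd : ContDiff ℝ 2 qd) {t : ℝ} (ht : 0 ≤ t) :
    HasDerivAt (fun s => qh s - qd s)
      (mv (mrpZ (qh t)) (omegaE Lam qd qh wh t) - mv Lam (qh t - qd t)) t := by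
  have hd : DifferentiableAt ℝ qd t := hqd.differentiable (by norm_num) t
  refine ((H.kinematics t ht).fun_sub hd.hasDerivAt).congr_deriv ?_
  have : wh t = omegaE Lam qd qh wh t + omegaR Lam qd qh t := by simp [omegaE]
  rw [this, mv_add, omegaR, mv_add, mv_mrpZ_mv_inv, mv_mrpZ_mv_inv, ← neg_sub (qh t) (qd t), mv_neg]
  abel

theorem norm_wh_le (R : ℝ) {t : ℝ} (h : ‖omegaR Lam qd qh t‖ ≤ R) :
    ‖wh t‖ ≤ ‖omegaE Lam qd qh wh t‖ + R := by
  have : wh t = omegaE Lam qd qh wh t + omegaR Lam qd qh t := by simp [omegaE]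
  calc ‖wh t‖ = ‖omegaE Lam qd qh wh t + omegaR Lam qd qh t‖ := by rw [← this]
    _ ≤ _ := (norm_add_le _ _).trans (by gcongr)

/-- The integral state. -/
noncomputable def _root_.integralState (Lam : M3) (KI : ℝ → M3) (qd qh wh : ℝ → V3) (t : ℝ) : V3 :=
  ∫ s in (0 : ℝ)..t, mv (KI s) (omegaE Lam qd qh wh s)

theorem continuousOn_omegaE (H : ClosedLoop J Jh Km Lam KI qd qh w wh dext)
    (hqd : ContDiff ℝ 2 qd) : ContinuousOn (omegaE Lam qd qh wh) (Ici 0) :=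
  fun _ ht => (H.differentiableAt_omegaE hqd ht).continuousAt.continuousWithinAt

theorem continuousOn_mv_KI {jm jM km kM c : ℝ} (G : GainBounds J Km KI jm jM km kM c)
    {e : ℝ → V3} (he : ContinuousOn e (Ici 0)) :
    ContinuousOn (fun s => mv (KI s) (e s)) (Ici 0) := by
  have h : ∀ i, ContinuousOn (fun s => KI s i i * e s i) (Ici 0) := fun i =>
    (G.continuousOn_KI i).mul
      (((continuous_apply i).comp (PiLp.continuous_ofLp 2 _)).comp_continuousOn he)
  have h2 : ContinuousOn (fun s => WithLp.toLp 2 (fun i => KI s i i * e s i)) (Ici 0) :=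
    (PiLp.continuous_toLp 2 _).comp_continuousOn (continuousOn_pi.2 h)
  refine h2.congr fun s hs => ?_
  ext i
  exact G.mv_KI hs (e s) i

theorem continuousOn_integralState {jm jM km kM c : ℝ}
    (H : ClosedLoop J Jh Km Lam KI qd qh w wh dext) (G : GainBounds J Km KI jm jM km kM c)
    (hqd : ContDiff ℝ 2 qd) : ContinuousOn (integralState Lam KI qd qh wh) (Ici 0) := by
  have hc := continuousOn_mv_KI G (H.continuousOn_omegaE hqd)
  intro t ht
  have h1 : ContinuousOn (integralState Lam KI qd qh wh) (Icc 0 (t + 1)) := by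
    have ht0 : (0 : ℝ) ≤ t + 1 := add_nonneg ht zero_le_one
    rw [← uIcc_of_le ht0]
    apply intervalIntegral.continuousOn_primitive_interval
    rw [uIcc_of_le ht0]
    exact (hc.mono Icc_subset_Ici_self).integrableOn_Icc
  exact (h1 t ⟨ht, le_add_of_nonneg_right zero_le_one⟩).mono_of_mem_nhdsWithin
    (inter_mem_nhdsWithin (Ici 0) (Iic_mem_nhds (lt_add_one t)))

/-- Strictly positive times only: a two-sided derivative at `0` would involve the gain at negative
times. -/
theorem hasDerivAt_integralState {jm jM km kM c : ℝ}
    (H : ClosedLoop J Jh Km Lam KI qd qh w wh dext) (G : GainBounds J Km KI jm jM km kM c)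
    (hqd : ContDiff ℝ 2 qd) {t : ℝ} (ht : 0 < t) :
    HasDerivAt (integralState Lam KI qd qh wh) (mv (KI t) (omegaE Lam qd qh wh t)) t := by
  have hc := continuousOn_mv_KI G (H.continuousOn_omegaE hqd)
  have hi : IntervalIntegrable (fun s => mv (KI s) (omegaE Lam qd qh wh s)) volume 0 t := by
    apply ContinuousOn.intervalIntegrable
    rw [uIcc_of_le ht.le]
    exact hc.mono Icc_subset_Ici_self
  exact intervalIntegral.integral_hasDerivAt_right hi
    ((hc.mono Ioi_subset_Ici_self).stronglyMeasurableAtFilter isOpen_Ioi t ht)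
    (hc.continuousAt (Ici_mem_nhds ht))

theorem errorSystem {jm jM km kM c : ℝ}
    (H : ClosedLoop J Jh Km Lam KI qd qh w wh dext) (G : GainBounds J Km KI jm jM km kM c)
    (hqd : ContDiff ℝ 2 qd) :
    ErrorSystem J Km KI wh (omegaE Lam qd qh wh) (integralState Lam KI qd qh wh)
      (dRes2 J Jh Lam qd qh w wh dext) 0 where
  cont_e := H.continuousOn_omegaE hqd
  cont_z := H.continuousOn_integralState G hqd
  deriv_e := fun t ht =>
    ⟨_, (H.differentiableAt_omegaE hqd ht.le).hasDerivAt, H.mv_deriv_omegaE hqd ht.le⟩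
  deriv_z := fun t ht => by simpa using H.hasDerivAt_integralState G hqd ht

/-- The error system after absorbing the disturbance into the integral state. -/
theorem errorSystem_shift {jm jM km kM c : ℝ}
    (H : ClosedLoop J Jh Km Lam KI qd qh w wh dext) (G : GainBounds J Km KI jm jM km kM c)
    (hqd : ContDiff ℝ 2 qd)
    (hcont : ContinuousOn (dRes2 J Jh Lam qd qh w wh dext) (Ici 0))
    (hdiff : ∀ t, 0 < t → DifferentiableAt ℝ (dRes2 J Jh Lam qd qh w wh dext) t) :
    ErrorSystem J Km KI wh (omegaE Lam qd qh wh)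
      (fun t => integralState Lam KI qd qh wh t - dRes2 J Jh Lam qd qh w wh dext t) 0
      (deriv (dRes2 J Jh Lam qd qh w wh dext)) where
  cont_e := H.continuousOn_omegaE hqd
  cont_z := (H.continuousOn_integralState G hqd).sub hcont
  deriv_e := fun t ht => ⟨_, (H.differentiableAt_omegaE hqd ht.le).hasDerivAt, by
    rw [H.mv_deriv_omegaE hqd ht.le]
    simp only [integralState, Pi.zero_apply]
    abel⟩
  deriv_z := fun t ht => (H.hasDerivAt_integralState G hqd ht).fun_sub (hdiff t ht).hasDerivAt

theorem integralState_zero : integralState Lam KI qd qh wh 0 = 0 := by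
  simp [integralState]

/-! ### The attitude error as a filter driven by the velocity error. -/

/-- Puts `‖q_e‖²` in the form required by `sqrt_comparison` and `eLpNorm_sqrt_le`, with `ζ‖e‖` as
input. -/
theorem attitude_deriv_le {l : ℝ} (hLam : ∀ x : V3, l * ‖x‖ ^ 2 ≤ inner ℝ x (mv Lam x))
    {ζ : ℝ} (t : ℝ) (hζ : sigmaMax (mrpZ (qh t)) ≤ ζ) :
    2 * inner ℝ (qh t - qd t)
        (mv (mrpZ (qh t)) (omegaE Lam qd qh wh t) - mv Lam (qh t - qd t)) ≤
      -(2 * l) * ‖qh t - qd t‖ ^ 2 + 2 * Real.sqrt (‖qh t - qd t‖ ^ 2) *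
        (ζ * ‖omegaE Lam qd qh wh t‖) := by
  rw [Real.sqrt_sq (norm_nonneg _), inner_sub_right]
  have h1 := hLam (qh t - qd t)
  have h2 := real_inner_le_norm (qh t - qd t) (mv (mrpZ (qh t)) (omegaE Lam qd qh wh t))
  have h3 : ‖mv (mrpZ (qh t)) (omegaE Lam qd qh wh t)‖ ≤ ζ * ‖omegaE Lam qd qh wh t‖ :=
    (norm_mv_le _ _).trans (by gcongr)
  have h4 := mul_le_mul_of_nonneg_left h3 (norm_nonneg (qh t - qd t))
  linarith

theorem continuousOn_attitudeError (H : ClosedLoop J Jh Km Lam KI qd qh w wh dext)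
    (hqd : ContDiff ℝ 2 qd) : ContinuousOn (fun t => qh t - qd t) (Ici 0) :=
  fun _ ht => (H.hasDerivAt_attitudeError hqd ht).continuousAt.continuousWithinAt

/-- The restriction `lam ≤ l / 2` avoids resonance between the filter and its input: `l - lam ≥ l /
2` bounds the cascade constant. -/
theorem attitude_comparison {l : ℝ} (H : ClosedLoop J Jh Km Lam KI qd qh w wh dext)
    (hqd : ContDiff ℝ 2 qd) (hl : 0 < l)
    (hLam : ∀ x : V3, l * ‖x‖ ^ 2 ≤ inner ℝ x (mv Lam x)) {ζ lam A D T : ℝ} (hT : 0 ≤ T)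
    (hlam : lam ≤ l / 2) (hA : 0 ≤ A) (hD : 0 ≤ D)
    (hζ : ∀ t, 0 ≤ t → sigmaMax (mrpZ (qh t)) ≤ ζ)
    (he : ∀ t ∈ Ioo 0 T, ‖omegaE Lam qd qh wh t‖ ≤ A * Real.exp (-lam * t) + D) :
    ‖qh T - qd T‖ ≤ Real.exp (-lam * T) * (‖qh 0 - qd 0‖ + 2 / l * ζ * A) + ζ * D / l := by
  have hζ0 : 0 ≤ ζ := (sigmaMax_nonneg _).trans (hζ 0 le_rfl)
  have key := sqrt_comparison (F := fun t => ‖qh t - qd t‖ ^ 2)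
    (g := fun t => ζ * ‖omegaE Lam qd qh wh t‖) (mu := lam) (A := ζ * A) (D := ζ * D) hT hl
    (by linarith) (((H.continuousOn_attitudeError hqd).mono Icc_subset_Ici_self).norm.pow 2)
    (fun t ht => (H.hasDerivAt_attitudeError hqd ht.1.le).norm_sq)
    (fun t _ => sq_nonneg _) (fun t ht => attitude_deriv_le hLam t (hζ t ht.1.le))
    (fun t _ => by positivity)
    (fun t ht => by
      have := mul_le_mul_of_nonneg_left (he t ht) hζ0
      rw [sub_zero]
      linarith) (by positivity) (by positivity)
  simp only [Real.sqrt_sq (norm_nonneg _), sub_zero] at key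
  have h1 : Real.exp (-l * T) ≤ Real.exp (-lam * T) := by
    apply Real.exp_le_exp.2
    nlinarith
  have h2 : ζ * A / (l - lam) ≤ 2 / l * ζ * A := by
    calc ζ * A / (l - lam) ≤ ζ * A / (l / 2) := by gcongr; linarith
      _ = _ := by field_simp
  have h3 := mul_le_mul_of_nonneg_right h1 (norm_nonneg (qh 0 - qd 0))
  have h4 := mul_le_mul_of_nonneg_right h2 (Real.exp_pos (-lam * T)).le
  linarith

theorem attitude_eLpNorm {l : ℝ} (H : ClosedLoop J Jh Km Lam KI qd qh w wh dext)
    (hqd : ContDiff ℝ 2 qd) (hl : 0 < l)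
    (hLam : ∀ x : V3, l * ‖x‖ ^ 2 ≤ inner ℝ x (mv Lam x)) {ζ T : ℝ} {p : ℝ≥0∞} (hT : 0 ≤ T)
    (hp : 1 ≤ p) (hζ : ∀ t, 0 ≤ t → sigmaMax (mrpZ (qh t)) ≤ ζ) :
    eLpNorm (fun t => qh t - qd t) p (volume.restrict (Icc 0 T)) ≤
      ENNReal.ofReal ((1 + 1 / l) * ‖qh 0 - qd 0‖) + ENNReal.ofReal (ζ / l) *
        eLpNorm (omegaE Lam qd qh wh) p (volume.restrict (Icc 0 T)) := by
  have hζ0 : 0 ≤ ζ := (sigmaMax_nonneg _).trans (hζ 0 le_rfl)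
  have key := eLpNorm_sqrt_le (F := fun t => ‖qh t - qd t‖ ^ 2)
    (g := fun t => ζ * ‖omegaE Lam qd qh wh t‖) hT hl hp
    (((H.continuousOn_attitudeError hqd).mono Icc_subset_Ici_self).norm.pow 2)
    (fun t ht => (H.hasDerivAt_attitudeError hqd ht.1.le).norm_sq)
    (fun t _ => sq_nonneg _) (fun t ht => attitude_deriv_le hLam t (hζ t ht.1.le))
    (fun t => by positivity)
    ((continuousOn_const.mul
      ((H.continuousOn_omegaE hqd).mono Icc_subset_Ici_self).norm).aestronglyMeasurable
        measurableSet_Icc)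
  simp only [Real.sqrt_sq (norm_nonneg _)] at key
  have h2 : eLpNorm (fun t => ζ * ‖omegaE Lam qd qh wh t‖) p (volume.restrict (Icc 0 T)) =
      ENNReal.ofReal ζ * eLpNorm (omegaE Lam qd qh wh) p (volume.restrict (Icc 0 T)) := by
    have : (fun t => ζ * ‖omegaE Lam qd qh wh t‖) = ζ • fun t => ‖omegaE Lam qd qh wh t‖ := by
      ext; simp
    rw [this, eLpNorm_const_smul, eLpNorm_norm, Real.enorm_eq_ofReal hζ0]
  rw [h2, eLpNorm_norm, ← mul_assoc, ← ENNReal.ofReal_mul (by positivity),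
    one_div_mul_eq_div] at key
  exact key

/-- The attitude stays bounded unless it tends to the singularity of the parametrization. -/
theorem exists_sigmaMax_le {l : ℝ} (H : ClosedLoop J Jh Km Lam KI qd qh w wh dext)
    (hqd : ContDiff ℝ 2 qd) (hqd_bdd : ∃ B : ℝ, ∀ t, 0 ≤ t → ‖qd t‖ ≤ B ∧ ‖deriv qd t‖ ≤ B)
    (hl : 0 < l) (hLam : ∀ x : V3, l * ‖x‖ ^ 2 ≤ inner ℝ x (mv Lam x))
    (he : Tendsto (fun t => ‖omegaE Lam qd qh wh t‖) atTop (nhds 0))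
    (hq : ¬ Tendsto (fun t => ‖qh t‖) atTop atTop) :
    ∃ ζ : ℝ, ∀ t, 0 ≤ t → sigmaMax (mrpZ (qh t)) ≤ ζ := by
  suffices hN : ∃ N : ℝ, ∀ t, 0 ≤ t → ‖qh t‖ ≤ N by
    obtain ⟨N, hN⟩ := hN
    refine ⟨(1 + N ^ 2) / 4, fun t ht => (sigmaMax_mrpZ_le _).trans ?_⟩
    have := hN t ht
    gcongr
  obtain ⟨B, hB⟩ := hqd_bdd
  have hB0 : 0 ≤ B := (norm_nonneg _).trans (hB 0 le_rfl).1
  -- If `‖q̂‖` does not tend to infinity, it lies below some level `R` at arbitrarily late times, in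
  -- particular when `e` is already small.
  rw [tendsto_atTop] at hq
  push Not at hq
  obtain ⟨R, hR⟩ := hq
  set ρ := |R| + B + 1 with hρ
  have hρ0 : 0 < ρ := by positivity
  -- On the sphere `‖q_e‖ = ρ` one has `σ_max(Z) ≤ (1 + (ρ + B)²)/4`, so an input below `η`
  -- contributes at most `l ρ / 4`, less than the damping `l ρ`. The ball is then forward invariant.
  set η := l * ρ / (1 + (ρ + B) ^ 2) with hη
  have hη0 : 0 < η := by positivity
  have hev : ∀ᶠ t in atTop, ‖omegaE Lam qd qh wh t‖ < η := he.eventually_lt_const hη0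
  obtain ⟨T, hT⟩ := eventually_atTop.1 hev
  obtain ⟨τ, hτR, hτ⟩ := (hR.and_eventually (eventually_ge_atTop (max T 0))).exists
  have hτ0 : 0 ≤ τ := (le_max_right _ _).trans hτ
  have hqhc : ContinuousOn qh (Ici 0) :=
    fun t ht => (H.kinematics t ht).continuousAt.continuousWithinAt
  obtain ⟨N1, hN1⟩ := isCompact_Icc.exists_bound_of_continuousOn
    (hqhc.mono (Icc_subset_Ici_self : Icc 0 τ ⊆ Ici 0))
  have hlate : ∀ t, τ ≤ t → ‖qh t - qd t‖ ^ 2 ≤ ρ ^ 2 := by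
    intro t ht
    apply image_le_of_deriv_right_lt_deriv_boundary (f := fun s => ‖qh s - qd s‖ ^ 2)
      (B := fun _ => ρ ^ 2) (B' := fun _ => 0) (a := τ) (b := t)
      (((H.continuousOn_attitudeError hqd).mono fun x hx => hτ0.trans hx.1).norm.pow 2)
      (fun s hs => ((H.hasDerivAt_attitudeError hqd
        (hτ0.trans hs.1)).norm_sq).hasDerivWithinAt) _ (fun s => hasDerivAt_const s _) _
      (right_mem_Icc.2 ht)
    · have h1 := norm_sub_le (qh τ) (qd τ)
      have h2 := (hB τ hτ0).1
      have h3 := le_abs_self R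
      have h4 : ‖qh τ - qd τ‖ ≤ ρ := by linarith
      gcongr
    · intro s hs hseq
      have hs0 := hτ0.trans hs.1
      have h1 : ‖qh s - qd s‖ = ρ := (sq_eq_sq₀ (norm_nonneg _) hρ0.le).1 hseq
      have h2 : ‖qh s‖ ≤ ρ + B := by
        have := norm_add_le (qh s - qd s) (qd s)
        rw [sub_add_cancel, h1] at this
        linarith [(hB s hs0).1]
      have h3 : sigmaMax (mrpZ (qh s)) ≤ (1 + (ρ + B) ^ 2) / 4 :=
        (sigmaMax_mrpZ_le _).trans (by gcongr)
      have h4 := attitude_deriv_le (qd := qd) (wh := wh) hLam s h3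
      refine h4.trans_lt ?_
      rw [Real.sqrt_sq (norm_nonneg _), h1]
      have h5 := hT s (((le_max_left _ _).trans hτ).trans hs.1)
      have h6 : (1 + (ρ + B) ^ 2) / 4 * ‖omegaE Lam qd qh wh s‖ ≤ (1 + (ρ + B) ^ 2) / 4 * η := by
        gcongr
      have h7 : (1 + (ρ + B) ^ 2) / 4 * η = l * ρ / 4 := by rw [hη]; field_simp
      have h8 := mul_le_mul_of_nonneg_left (h6.trans_eq h7) hρ0.le
      have h9 : 0 < l * ρ ^ 2 := by positivity
      linarith
  refine ⟨max N1 (ρ + B), fun t ht => ?_⟩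
  rcases le_total t τ with h | h
  · exact (hN1 t ⟨ht, h⟩).trans (le_max_left _ _)
  · have h1 := (sq_le_sq₀ (norm_nonneg _) hρ0.le).1 (hlate t h)
    have h2 := norm_add_le (qh t - qd t) (qd t)
    rw [sub_add_cancel] at h2
    exact le_max_of_le_right (by linarith [(hB t ht).1])

end ClosedLoop

/-! ### Assembly of the stability theorem. -/

theorem GainBounds.energy_le_sq {J Km : M3} {KI : ℝ → M3} {jm jM km kM c : ℝ}
    (G : GainBounds J Km KI jm jM km kM c) (e z : ℝ → V3) {t r : ℝ} (ht : 0 ≤ t)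
    (hr : ‖e t‖ + ‖z t‖ ≤ r) : energy J KI e z t ≤ ((jM + 1 + c) * r) ^ 2 := by
  have hj := G.jM_pos
  have hc := G.c_pos
  have hr0 : 0 ≤ r := le_trans (by positivity) hr
  exact (Real.sqrt_le_left (by positivity)).1 ((G.sqrt_energy_le e z ht).trans (by gcongr))

/-- Used to pass from the integral state to the shifted state at the end of the transient. -/
theorem GainBounds.energy_sub_le {J Km : M3} {KI : ℝ → M3} {jm jM km kM c : ℝ}
    (G : GainBounds J Km KI jm jM km kM c) (e y d : ℝ → V3) {t : ℝ} (ht : 0 ≤ t) :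
    energy J KI e (fun s => y s - d s) t ≤ 2 * energy J KI e y t + c ^ 2 * ‖d t‖ ^ 2 := by
  have h1 : weightedSq KI (fun s => y s - d s) t ≤ 2 * weightedSq KI y t + 2 * weightedSq KI d t := by
    unfold weightedSq
    rw [Finset.mul_sum, Finset.mul_sum, ← Finset.sum_add_distrib]
    refine Finset.sum_le_sum fun i _ => ?_
    have hk := G.KI_pos t ht i
    rw [← mul_div_assoc, ← mul_div_assoc, ← add_div]
    gcongr
    simp only [PiLp.sub_apply]
    nlinarith [sq_nonneg (y t i + d t i)]
  have h2 := G.weightedSq_le d ht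
  have h3 := G.J_lower (e t)
  have h4 : 0 ≤ jm * ‖e t‖ ^ 2 := by have := G.jm_pos; positivity
  unfold energy
  linarith

/-- Decay that starts only at time `T` becomes decay from time `0` at the price of a factor `exp
(lam * T)`. -/
theorem exp_neg_mul_sub_le {lam mu t T : ℝ} (h : lam ≤ mu) (ht : T ≤ t) :
    Real.exp (-mu * (t - T)) ≤ Real.exp (lam * T) * Real.exp (-lam * t) := by
  rw [← Real.exp_add]
  apply Real.exp_le_exp.2
  nlinarith

theorem one_le_exp_mul_exp {lam t T : ℝ} (h : 0 ≤ lam) (ht : t ≤ T) :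
    1 ≤ Real.exp (lam * T) * Real.exp (-lam * t) := by
  rw [← Real.exp_add]
  apply Real.one_le_exp
  nlinarith

set_option maxHeartbeats 1000000 in
theorem mainTheorem3
    (J Km Lam : M3) (KI : ℝ → M3) (qd : ℝ → V3)
    (hJ : J.PosDef) (hKm : PosDefForm Km) (hLam : PosDefForm Lam)
    (hKI_diag : ∀ t, 0 ≤ t → (KI t).IsDiag)
    (hKI_pos : ∃ κ : ℝ, 0 < κ ∧ ∀ t, 0 ≤ t → ∀ i, κ ≤ KI t i i)
    (hKI_diff : ∀ t, 0 ≤ t → ∀ i, DifferentiableAt ℝ (fun s => KI s i i) t)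
    (hKI_mono : ∀ t, 0 ≤ t → ∀ i, 0 ≤ deriv (fun s => KI s i i) t)
    (hqd : ContDiff ℝ 2 qd)
    (hqd_bdd : ∃ B : ℝ, ∀ t, 0 ≤ t → ‖qd t‖ ≤ B ∧ ‖deriv qd t‖ ≤ B) :
    -- (i) constant disturbance: global exponential convergence, the rate being independent
    -- of the initial condition and of the disturbance
    (∃ lam : ℝ, 0 < lam ∧ ∀ r : ℝ, ∃ C : ℝ, 0 ≤ C ∧
      ∀ (Jh : M3) (qh w wh dext : ℝ → V3) (c : V3),
        ClosedLoop J Jh Km Lam KI qd qh w wh dext →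
        (∀ t, 0 ≤ t → dRes2 J Jh Lam qd qh w wh dext t = c) →
        ‖omegaE Lam qd qh wh 0‖ + ‖c‖ ≤ r →
        (∀ t, 0 ≤ t → ‖omegaE Lam qd qh wh t‖ ≤
          C * Real.exp (-lam * t) * (‖omegaE Lam qd qh wh 0‖ + ‖c‖)) ∧
        (∀ ζ : ℝ, (∀ t, 0 ≤ t → sigmaMax (mrpZ (qh t)) ≤ ζ) →
          ∀ t, 0 ≤ t → ‖qh t - qd t‖ ≤
            Real.exp (-lam * t) *
              (‖qh 0 - qd 0‖ + C * ζ * (‖omegaE Lam qd qh wh 0‖ + ‖c‖))) ∧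
        (¬ Tendsto (fun t => ‖qh t‖) atTop atTop →
          ∃ ζ : ℝ, ∀ t, 0 ≤ t → sigmaMax (mrpZ (qh t)) ≤ ζ)) ∧
    -- (ii-a) bounded disturbances keep the angular velocity bounded
    (∀ r D0 : ℝ, ∃ W : ℝ,
      ∀ (Jh : M3) (qh w wh dext : ℝ → V3),
        ClosedLoop J Jh Km Lam KI qd qh w wh dext →
        ‖omegaE Lam qd qh wh 0‖ ≤ r →
        (∀ t, 0 ≤ t → ‖dRes2 J Jh Lam qd qh w wh dext t‖ ≤ D0) →
        ∀ t, 0 ≤ t → ‖wh t‖ ≤ W) ∧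
    -- (ii-b) input-to-state stability and finite-gain L_p stability with respect to the rate
    -- of the disturbance
    (∀ W : ℝ, ∃ lam C γ : ℝ, 0 < lam ∧ 0 < C ∧ 0 < γ ∧
      ∀ (Jh : M3) (qh w wh dext : ℝ → V3),
        ClosedLoop J Jh Km Lam KI qd qh w wh dext →
        (∀ t, 0 ≤ t → ‖wh t‖ ≤ W) →
        (∀ t, 0 ≤ t → DifferentiableAt ℝ (dRes2 J Jh Lam qd qh w wh dext) t) →
        -- input-to-state stability
        (∀ T D : ℝ, 0 ≤ T →
          (∀ s ∈ Icc 0 T, ‖deriv (dRes2 J Jh Lam qd qh w wh dext) s‖ ≤ D) →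
          ‖omegaE Lam qd qh wh T‖ ≤
            C * Real.exp (-lam * T) *
              (‖omegaE Lam qd qh wh 0‖ + ‖dRes2 J Jh Lam qd qh w wh dext 0‖) + γ * D ∧
          ∀ ζ : ℝ, (∀ t, 0 ≤ t → sigmaMax (mrpZ (qh t)) ≤ ζ) →
            ‖qh T - qd T‖ ≤
              Real.exp (-lam * T) *
                (‖qh 0 - qd 0‖ + C * ζ *
                  (‖omegaE Lam qd qh wh 0‖ + ‖dRes2 J Jh Lam qd qh w wh dext 0‖))
              + γ * ζ * D) ∧
        -- finite-gain stability in every L_p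
        (∀ (p : ℝ≥0∞) (T : ℝ), 1 ≤ p → 0 ≤ T →
          eLpNorm (omegaE Lam qd qh wh) p (volume.restrict (Icc 0 T)) ≤
            ENNReal.ofReal
              (C * (‖omegaE Lam qd qh wh 0‖ + ‖dRes2 J Jh Lam qd qh w wh dext 0‖))
            + ENNReal.ofReal γ *
              eLpNorm (deriv (dRes2 J Jh Lam qd qh w wh dext)) p (volume.restrict (Icc 0 T)) ∧
          ∀ ζ : ℝ, (∀ t, 0 ≤ t → sigmaMax (mrpZ (qh t)) ≤ ζ) →
            eLpNorm (fun t => qh t - qd t) p (volume.restrict (Icc 0 T)) ≤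
              ENNReal.ofReal
                (C * (‖qh 0 - qd 0‖ + ζ *
                  (‖omegaE Lam qd qh wh 0‖ + ‖dRes2 J Jh Lam qd qh w wh dext 0‖)))
              + ENNReal.ofReal (γ * ζ) *
                eLpNorm (deriv (dRes2 J Jh Lam qd qh w wh dext)) p
                  (volume.restrict (Icc 0 T)))) ∧
    -- (ii-c) global exponential convergence to a ball whose radius is proportional to the bound
    -- on the rate of the disturbance, rate and gain being independent of the initial condition
    (∀ D0 : ℝ, ∃ lam γ : ℝ, 0 < lam ∧ 0 < γ ∧ ∀ r : ℝ, ∃ C : ℝ, 0 ≤ C ∧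
      ∀ (Jh : M3) (qh w wh dext : ℝ → V3) (D : ℝ),
        ClosedLoop J Jh Km Lam KI qd qh w wh dext →
        ‖omegaE Lam qd qh wh 0‖ ≤ r →
        (∀ t, 0 ≤ t → ‖dRes2 J Jh Lam qd qh w wh dext t‖ ≤ D0) →
        (∀ t, 0 ≤ t → DifferentiableAt ℝ (dRes2 J Jh Lam qd qh w wh dext) t) →
        (∀ t, 0 ≤ t → ‖deriv (dRes2 J Jh Lam qd qh w wh dext) t‖ ≤ D) →
        (∀ t, 0 ≤ t → ‖omegaE Lam qd qh wh t‖ ≤ C * Real.exp (-lam * t) + γ * D) ∧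
        (∀ ζ : ℝ, (∀ t, 0 ≤ t → sigmaMax (mrpZ (qh t)) ≤ ζ) →
          ∀ t, 0 ≤ t → ‖qh t - qd t‖ ≤
            Real.exp (-lam * t) * (‖qh 0 - qd 0‖ + C * ζ) + γ * ζ * D)) := by
  obtain ⟨jm, jM, km, kM, c₀, G⟩ := exists_gainBounds hJ hKm hKI_diag hKI_pos hKI_diff hKI_mono
  obtain ⟨R, hR, hωr⟩ := exists_norm_omegaR_le Lam hqd_bdd
  obtain ⟨l, hl, hLam'⟩ := hLam.exists_coercive
  have hjm := G.jm_pos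
  have hjM := G.jM_pos
  have hc₀ := G.c_pos
  set s := Real.sqrt (2 / jm) with hs
  have hs0 : 0 < s := Real.sqrt_pos.2 (by positivity)
  set κ := jM + 1 + c₀ with hκ
  have hκ0 : 0 < κ := by positivity
  refine ⟨?_, ?_, ?_, ?_⟩
  -- For constant `d` the shifted system has neither disturbance nor rate, so the ultimate bound
  -- applies with `D₀ = 0`. The rate `lam₁` depends on `Vs` alone, hence not on `r`.
  · obtain ⟨Vs, hVs, hult⟩ := G.exists_ultimate_bound hR 0
    obtain ⟨lam₁, γ₁, C₁, hlam₁, hγ₁, hC₁, hdec₁⟩ :=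
      G.exists_energy_decay (W := s * Real.sqrt Vs + R) (by positivity)
    set lam := min lam₁ (l / 2) with hlam
    have hlam0 : 0 < lam := by positivity
    refine ⟨lam, hlam0, fun r => ?_⟩
    obtain ⟨T, B, hT, hB, hult⟩ := hult ((κ * r) ^ 2)
    -- This second estimate, whose constants depend on `r`, serves only to make the transient
    -- proportional to `x₀`; its rate is discarded.
    obtain ⟨lam₂, γ₂, C₂, hlam₂, hγ₂, hC₂, hdec₂⟩ :=
      G.exists_energy_decay (W := s * Real.sqrt B + R) (by positivity)
    -- The `1` covers times before `T`, the `C₁` times after it.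
    set A := s * Real.exp (lam * T) * ((1 + C₁) * (C₂ * κ)) with hA
    have hA0 : 0 < A := by positivity
    refine ⟨A + 2 / l * A, by positivity, fun Jh qh w wh dext c H hdc hx => ?_⟩
    set e := omegaE Lam qd qh wh with he
    set x₀ := ‖e 0‖ + ‖c‖ with hx₀
    have hx₀0 : 0 ≤ x₀ := by positivity
    have hd0 : ∀ t, 0 < t → HasDerivAt (dRes2 J Jh Lam qd qh w wh dext) 0 t := fun t ht =>
      (hasDerivAt_const t c).congr_of_eventuallyEq (by
        filter_upwards [Ioi_mem_nhds ht] with u hu using hdc u (le_of_lt hu))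
    have S := H.errorSystem_shift G hqd (continuousOn_const.congr hdc)
      fun t ht => (hd0 t ht).differentiableAt
    set z := fun t => integralState Lam KI qd qh wh t - dRes2 J Jh Lam qd qh w wh dext t with hz
    have hz0 : ‖z 0‖ = ‖c‖ := by
      simp [hz, ClosedLoop.integralState_zero, hdc 0 le_rfl]
    have hE0 : energy J KI e z 0 ≤ (κ * r) ^ 2 := G.energy_le_sq e z le_rfl (by rw [hz0]; exact hx)
    have hbd := hult wh e z _ _ S (fun t ht => (hd0 t ht).deriv) (fun t _ => by simp)
      (fun t ht => ClosedLoop.norm_wh_le R (hωr qh t ht.le)) hE0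
    have hwh : ∀ V t, 0 ≤ t → energy J KI e z t ≤ V → ‖wh t‖ ≤ s * Real.sqrt V + R := by
      intro V t ht hV
      refine (ClosedLoop.norm_wh_le R (hωr qh t ht)).trans ?_
      have h1 := G.norm_le_sqrt_energy e z ht
      have h2 := mul_le_mul_of_nonneg_left (Real.sqrt_le_sqrt hV) hs0.le
      linarith
    have hall : ∀ t, 0 ≤ t → Real.sqrt (energy J KI e z t) ≤ C₂ * κ * x₀ := by
      intro t ht
      have h1 := hdec₂ wh e z _ _ S (fun t _ => rfl) 0 t 0 le_rfl ht le_rfl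
        (fun u hu => hwh B u hu.1.le (hbd u hu.1.le).1)
        (fun u hu => by rw [(hd0 u hu.1).deriv, norm_zero])
      have h2 := G.sqrt_energy_le e z le_rfl
      rw [hz0] at h2
      have h3 : Real.exp (-lam₂ * (t - 0)) ≤ 1 := Real.exp_le_one_iff.2 (by nlinarith)
      calc _ ≤ _ := h1
        _ ≤ C₂ * 1 * (κ * x₀) + γ₂ * 0 := by gcongr
        _ = _ := by ring
    have hmain : ∀ t, 0 ≤ t → ‖e t‖ ≤ A * x₀ * Real.exp (-lam * t) := by
      intro t ht
      refine (G.norm_le_sqrt_energy e z ht).trans ?_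
      rcases le_total t T with h | h
      · have h1 := one_le_exp_mul_exp hlam0.le h
        calc s * Real.sqrt (energy J KI e z t) ≤ s * (C₂ * κ * x₀) := by gcongr; exact hall t ht
          _ = s * (1 * ((1 + 0) * (C₂ * κ))) * x₀ := by ring
          _ ≤ s * (Real.exp (lam * T) * Real.exp (-lam * t) * ((1 + C₁) * (C₂ * κ))) * x₀ := by
            gcongr
          _ = _ := by rw [hA]; ring
      · have h1 := hdec₁ wh e z _ _ S (fun t _ => rfl) T t 0 hT h le_rfl
          (fun u hu => hwh Vs u (hT.trans hu.1.le) ((hbd u (hT.trans hu.1.le)).2 hu.1.le))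
          (fun u hu => by rw [(hd0 u (hT.trans_lt hu.1)).deriv, norm_zero])
        have h2 := exp_neg_mul_sub_le (min_le_left lam₁ (l / 2)) h
        calc s * Real.sqrt (energy J KI e z t)
            ≤ s * (C₁ * (Real.exp (lam * T) * Real.exp (-lam * t)) * (C₂ * κ * x₀) + γ₁ * 0) := by
              gcongr
              refine h1.trans ?_
              gcongr
              exact hall T hT
          _ ≤ s * ((1 + C₁) * (Real.exp (lam * T) * Real.exp (-lam * t)) * (C₂ * κ * x₀)
                + γ₁ * 0) := by
              gcongr
              linarith
          _ = _ := by rw [hA]; ring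
    refine ⟨fun t ht => ?_, fun ζ hζ t ht => ?_, fun hq => ?_⟩
    · refine (hmain t ht).trans ?_
      have : 0 ≤ 2 / l * A * x₀ * Real.exp (-lam * t) := by positivity
      linarith
    · have hζ0 : 0 ≤ ζ := (sigmaMax_nonneg _).trans (hζ 0 le_rfl)
      have h1 := H.attitude_comparison hqd hl hLam' ht (min_le_right _ _) (A := A * x₀) (D := 0)
        (by positivity) le_rfl hζ (fun u hu => by rw [add_zero]; exact hmain u hu.1.le)
      have h2 : 0 ≤ Real.exp (-lam * t) * (A * ζ * x₀) := by positivity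
      rw [mul_zero, zero_div, add_zero] at h1
      refine h1.trans ?_
      linarith
    · refine H.exists_sigmaMax_le hqd hqd_bdd hl hLam' ?_ hq
      have h1 : Tendsto (fun t => A * x₀ * Real.exp (-lam * t)) atTop (nhds 0) := by
        have : Tendsto (fun t => Real.exp (-(lam * t))) atTop (nhds 0) :=
          Real.tendsto_exp_neg_atTop_nhds_zero.comp (tendsto_id.const_mul_atTop hlam0)
        simpa using this.const_mul (A * x₀)
      exact tendsto_of_tendsto_of_tendsto_of_le_of_le' tendsto_const_nhds h1
        (Eventually.of_forall fun _ => norm_nonneg _)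
        (by filter_upwards [eventually_ge_atTop 0] with t ht using hmain t ht)
  · intro r D0
    obtain ⟨Vs, hVs, hult⟩ := G.exists_ultimate_bound hR D0
    obtain ⟨T, B, hT, hB, hult⟩ := hult ((κ * r) ^ 2)
    refine ⟨s * Real.sqrt B + R, fun Jh qh w wh dext H hr hd t ht => ?_⟩
    -- The unshifted system is used, with `d` as a bounded forcing term, so no derivative of `d` is
    -- needed.
    have S := H.errorSystem G hqd
    set e := omegaE Lam qd qh wh with he
    set y := integralState Lam KI qd qh wh with hy
    have hE0 : energy J KI e y 0 ≤ (κ * r) ^ 2 := G.energy_le_sq e y le_rfl (by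
      rw [hy, ClosedLoop.integralState_zero, norm_zero, add_zero]; exact hr)
    have hbd := hult wh e y _ _ S (fun t _ => rfl)
      (fun t ht => hd t ht.le)
      (fun t ht => ClosedLoop.norm_wh_le R (hωr qh t ht.le)) hE0 t ht
    refine (ClosedLoop.norm_wh_le R (hωr qh t ht)).trans ?_
    have h1 := G.norm_le_sqrt_energy e y ht
    have h2 := mul_le_mul_of_nonneg_left (Real.sqrt_le_sqrt hbd.1) hs0.le
    linarith
  · intro W
    obtain ⟨lam₁, γ₁, C₁, hlam₁, hγ₁, hC₁, hdec⟩ := G.exists_energy_decay (le_max_right W 0)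
    obtain ⟨γ₂, C₂, hγ₂, hC₂, hLp⟩ := G.exists_energy_eLpNorm (le_max_right W 0)
    set lam := min lam₁ (l / 2) with hlam
    have hlam0 : 0 < lam := by positivity
    set A := s * (C₁ * κ) with hA
    have hA0 : 0 < A := by positivity
    -- The constants are sums of those needed in the four estimates: pointwise and `L^p`, for the
    -- velocity and for the attitude.
    refine ⟨lam, A + 2 / l * A + C₂ + (1 + 1 / l) + C₂ / l,
      s * γ₁ + s * γ₁ / l + γ₂ + γ₂ / l, hlam0, by positivity, by positivity,
      fun Jh qh w wh dext H hW hdiff => ?_⟩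
    set e := omegaE Lam qd qh wh with he
    set d := dRes2 J Jh Lam qd qh w wh dext with hd
    have S := H.errorSystem_shift G hqd
      (fun t ht => (hdiff t ht).continuousAt.continuousWithinAt) fun t ht => hdiff t ht.le
    rw [← hd, ← he] at S
    set z := fun t => integralState Lam KI qd qh wh t - d t with hz
    have hz0 : ‖z 0‖ = ‖d 0‖ := by simp [hz, ClosedLoop.integralState_zero]
    set x₀ := ‖e 0‖ + ‖d 0‖ with hx₀
    have hx₀0 : 0 ≤ x₀ := by positivity
    have hW' : ∀ t, 0 ≤ t → ‖wh t‖ ≤ max W 0 := fun t ht => (hW t ht).trans (le_max_left _ _)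
    refine ⟨fun T D hT hD => ?_, fun p T hp hT => ?_⟩
    · have hD0 : 0 ≤ D := (norm_nonneg _).trans (hD 0 (left_mem_Icc.2 hT))
      have hmain : ∀ t ∈ Icc 0 T, ‖e t‖ ≤ A * x₀ * Real.exp (-lam * t) + s * γ₁ * D := by
        intro t ht
        have h1 := hdec wh e z _ _ S (fun t _ => rfl) 0 t D le_rfl ht.1 hD0
          (fun u hu => hW' u hu.1.le) (fun u hu => hD u ⟨hu.1.le, hu.2.le.trans ht.2⟩)
        have h2 := G.sqrt_energy_le e z le_rfl
        rw [hz0] at h2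
        have h3 : Real.exp (-lam₁ * (t - 0)) ≤ Real.exp (-lam * t) := by
          simpa using exp_neg_mul_sub_le (min_le_left lam₁ (l / 2)) ht.1
        calc ‖e t‖ ≤ s * Real.sqrt (energy J KI e z t) := G.norm_le_sqrt_energy e z ht.1
          _ ≤ s * (C₁ * Real.exp (-lam * t) * (κ * x₀) + γ₁ * D) := by
              gcongr
              refine h1.trans ?_
              gcongr
          _ = _ := by rw [hA]; ring
      refine ⟨?_, fun ζ hζ => ?_⟩
      · refine (hmain T (right_mem_Icc.2 hT)).trans ?_
        have h1 : A * x₀ * Real.exp (-lam * T) ≤ (A + 2 / l * A + C₂ + (1 + 1 / l) + C₂ / l) *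
            x₀ * Real.exp (-lam * T) := by
          gcongr
          have : 0 ≤ 2 / l * A + C₂ + (1 + 1 / l) + C₂ / l := by positivity
          linarith
        have h2 : s * γ₁ * D ≤ (s * γ₁ + s * γ₁ / l + γ₂ + γ₂ / l) * D := by
          gcongr
          have : 0 ≤ s * γ₁ / l + γ₂ + γ₂ / l := by positivity
          linarith
        linarith
      · have hζ0 : 0 ≤ ζ := (sigmaMax_nonneg _).trans (hζ 0 le_rfl)
        have h1 := H.attitude_comparison hqd hl hLam' hT (min_le_right _ _) (A := A * x₀)
          (D := s * γ₁ * D) (by positivity) (by positivity) hζ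
          (fun u hu => hmain u (Ioo_subset_Icc_self hu))
        have h2 : Real.exp (-lam * T) * (‖qh 0 - qd 0‖ + 2 / l * A * ζ * x₀) ≤
            Real.exp (-lam * T) * (‖qh 0 - qd 0‖ +
              (A + 2 / l * A + C₂ + (1 + 1 / l) + C₂ / l) * ζ * x₀) := by
          gcongr
          have : 0 ≤ C₂ + (1 + 1 / l) + C₂ / l := by positivity
          linarith
        have h3 : s * γ₁ / l * ζ * D ≤ (s * γ₁ + s * γ₁ / l + γ₂ + γ₂ / l) * ζ * D := by
          gcongr
          have : 0 ≤ s * γ₁ + γ₂ + γ₂ / l := by positivity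
          linarith
        have h4 : ζ * (s * γ₁ * D) / l = s * γ₁ / l * ζ * D := by ring
        rw [h4] at h1
        linarith
    · have hmain := hLp wh e z _ _ S (fun t _ => rfl) hW' (stronglyMeasurable_deriv d) p T hp hT
      rw [hz0] at hmain
      refine ⟨hmain.trans ?_, fun ζ hζ => ?_⟩
      · gcongr
        · have : 0 ≤ A + 2 / l * A + (1 + 1 / l) + C₂ / l := by positivity
          linarith
        · have : 0 ≤ s * γ₁ + s * γ₁ / l + γ₂ / l := by positivity
          linarith
      · have hζ0 : 0 ≤ ζ := (sigmaMax_nonneg _).trans (hζ 0 le_rfl)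
        have h1 := H.attitude_eLpNorm hqd hl hLam' hT hp hζ
        refine h1.trans ((add_le_add_right (mul_le_mul_right hmain _) _).trans ?_)
        rw [mul_add, ← add_assoc, ← mul_assoc, ← ENNReal.ofReal_mul (by positivity),
          ← ENNReal.ofReal_mul (by positivity), ← ENNReal.ofReal_add (by positivity)
          (by positivity)]
        have h3 : ζ / l * γ₂ ≤ (s * γ₁ + s * γ₁ / l + γ₂ + γ₂ / l) * ζ := by
          have : 0 ≤ (s * γ₁ + s * γ₁ / l + γ₂) * ζ := by positivity
          have h2 : ζ / l * γ₂ = γ₂ / l * ζ := by ring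
          linarith
        refine add_le_add (ENNReal.ofReal_le_ofReal ?_)
          (mul_le_mul_left (ENNReal.ofReal_le_ofReal h3) _)
        · have : 0 ≤ (A + 2 / l * A + C₂ + C₂ / l) * ‖qh 0 - qd 0‖ +
            (A + 2 / l * A + C₂ + (1 + 1 / l)) * (ζ * x₀) := by positivity
          have h2 : ζ / l * (C₂ * x₀) = C₂ / l * (ζ * x₀) := by ring
          linarith
  · intro D0
    obtain ⟨Vs, hVs, hult⟩ := G.exists_ultimate_bound hR D0
    obtain ⟨lam₁, γ₁, C₁, hlam₁, hγ₁, hC₁, hdec₁⟩ :=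
      G.exists_energy_decay (W := s * Real.sqrt Vs + R) (by positivity)
    set lam := min lam₁ (l / 2) with hlam
    have hlam0 : 0 < lam := by positivity
    refine ⟨lam, s * γ₁ + s * γ₁ / l, hlam0, by positivity, fun r => ?_⟩
    obtain ⟨T, B, hT, hB, hult⟩ := hult ((κ * r) ^ 2)
    -- Bound on the shifted energy at time `T`, obtained from the unshifted one and `‖d‖ ≤ D0`.
    set Bz := 2 * B + c₀ ^ 2 * D0 ^ 2 with hBz
    set A := s * Real.exp (lam * T) * (Real.sqrt B + C₁ * Real.sqrt Bz) with hA
    have hA0 : 0 ≤ A := by positivity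
    refine ⟨A + 2 / l * A, by positivity, fun Jh qh w wh dext D H hr hdb hdiff hdD => ?_⟩
    have hD0 : 0 ≤ D := (norm_nonneg _).trans (hdD 0 le_rfl)
    -- The same trajectory is viewed in two ways: unshifted to bring the velocity below an
    -- `r`-independent bound, shifted to obtain decay up to a multiple of `D` afterwards.
    have S₀ := H.errorSystem G hqd
    have S := H.errorSystem_shift G hqd
      (fun t ht => (hdiff t ht).continuousAt.continuousWithinAt) fun t ht => hdiff t ht.le
    set e := omegaE Lam qd qh wh with he
    set d := dRes2 J Jh Lam qd qh w wh dext with hd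
    set y := integralState Lam KI qd qh wh with hy
    set z := fun t => y t - d t with hz
    have hE0 : energy J KI e y 0 ≤ (κ * r) ^ 2 := G.energy_le_sq e y le_rfl (by
      rw [hy, ClosedLoop.integralState_zero, norm_zero, add_zero]; exact hr)
    have hbd := hult wh e y _ _ S₀ (fun t _ => rfl)
      (fun t ht => hdb t ht.le)
      (fun t ht => ClosedLoop.norm_wh_le R (hωr qh t ht.le)) hE0
    have hmain : ∀ t, 0 ≤ t → ‖e t‖ ≤ A * Real.exp (-lam * t) + s * γ₁ * D := by
      intro t ht
      rcases le_total t T with h | h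
      · have h1 := one_le_exp_mul_exp hlam0.le h
        calc ‖e t‖ ≤ s * Real.sqrt (energy J KI e y t) := G.norm_le_sqrt_energy e y ht
          _ ≤ s * Real.sqrt B := by gcongr; exact (hbd t ht).1
          _ = s * (1 * (Real.sqrt B + 0)) + 0 := by ring
          _ ≤ s * (Real.exp (lam * T) * Real.exp (-lam * t) *
                (Real.sqrt B + C₁ * Real.sqrt Bz)) + s * γ₁ * D := by
              gcongr <;> positivity
          _ = _ := by rw [hA]; ring
      · have h1 := hdec₁ wh e z _ _ S (fun t _ => rfl) T t D hT h hD0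
          (fun u hu => by
            have hu0 := hT.trans hu.1.le
            refine (ClosedLoop.norm_wh_le R (hωr qh u hu0)).trans ?_
            have h1 := G.norm_le_sqrt_energy e y hu0
            have h2 := mul_le_mul_of_nonneg_left
              (Real.sqrt_le_sqrt ((hbd u hu0).2 hu.1.le)) hs0.le
            linarith)
          (fun u hu => hdD u (hT.trans hu.1.le))
        have h2 := exp_neg_mul_sub_le (min_le_left lam₁ (l / 2)) h
        have h3 : energy J KI e z T ≤ Bz := by
          refine (G.energy_sub_le e y d hT).trans ?_
          have := (hbd T hT).1
          have := hdb T hT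
          rw [hBz]
          gcongr
        calc ‖e t‖ ≤ s * Real.sqrt (energy J KI e z t) := G.norm_le_sqrt_energy e z ht
          _ ≤ s * (C₁ * (Real.exp (lam * T) * Real.exp (-lam * t)) * Real.sqrt Bz + γ₁ * D) := by
              gcongr
              refine h1.trans ?_
              gcongr
          _ ≤ s * (C₁ * (Real.exp (lam * T) * Real.exp (-lam * t)) * Real.sqrt Bz + γ₁ * D)
                + s * (Real.exp (lam * T) * Real.exp (-lam * t)) * Real.sqrt B :=
              le_add_of_nonneg_right (by positivity)
          _ = _ := by rw [hA]; ring
    refine ⟨fun t ht => ?_, fun ζ hζ t ht => ?_⟩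
    · have h1 : 0 ≤ 2 / l * A * Real.exp (-lam * t) := by positivity
      have h2 : 0 ≤ s * γ₁ / l * D := by positivity
      linarith [hmain t ht]
    · have hζ0 : 0 ≤ ζ := (sigmaMax_nonneg _).trans (hζ 0 le_rfl)
      have h1 := H.attitude_comparison hqd hl hLam' ht (min_le_right _ _) (A := A)
        (D := s * γ₁ * D) hA0 (by positivity) hζ (fun u hu => hmain u hu.1.le)
      have h2 : 0 ≤ Real.exp (-lam * t) * (A * ζ) := by positivity
      have h3 : 0 ≤ s * γ₁ * ζ * D := by positivity
      have h4 : ζ * (s * γ₁ * D) / l = s * γ₁ / l * ζ * D := by ring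
      rw [h4] at h1
      linarith
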